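/- Let $t\ge 0$, let $d_1,\dots,d_t\ge 1$ and $h_1,\dots,h_t\ge 0$ be integers, and put $D_i=d_1+\cdots+d_i$, $H_i=h_1+\cdots+h_i$, $D_0=d_0=0$, $n=D_t$. Let $B=B(h_1,d_1;\dots;h_t,d_t)$ be the Ferrers board with $n$ columns, aligned at the top, whose first $d_1$ columns have height $H_1$, whose next $d_2$ columns have height $H_2$, and so on, up to the last $d_t$ columns, which have height $H_t$; $H_t>n$ is allowed (inadmissible boards). Let $\mathrm{Area}(B)$ be the number of squares of $B$. Write $[m]=1+q+\cdots+q^{m-1}$ and $[m]!=[1][2]\cdots[m]$. Let $R_k(B)=\sum_C q^{\mathrm{inv}(C,B)}$, summed over all placements $C$ of $k$ rooks on squares of $B$, no two in the same row or column, where $\mathrm{inv}(C,B)$ is the number of squares of $B$ that neither contain a rook nor lie above a rook in its column or to the right of a rook in its row. Define $T_0(B),\dots,T_n(B)\in\mathbb Z[q]$ by $$\sum_{k=0}^n [k]!\,R_{n-k}(B)\prod_{i=k+1}^n (x-q^i)=\sum_{k=0}^n T_k(B)\,x^k .$$ A nonzero polynomial $f=\sum_{j=M}^N a_jq^j$ with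 $a_M,a_N\neq 0$ is called symmetric if $a_{M+j}=a_{N-j}$ for $0\le j\le N-M$, unimodal if $a_M\le\cdots\le a_p\ge\cdots\ge a_N$ for some $M\le p\le N$, and its darga is $M+N$. For $0\le k\le n$ put $$L_k(B)=\mathrm{Area}(B)+n(n-k)-\sum_{i=1}^t D_id_i,\qquad N_k(B)=\mathrm{Area}(B)+n(n-k)-\binom{n+1}{2}=L_k(B)+\sum_{i=1}^t\binom{d_i}{2}.$$ **Theorem.** For $0\le k\le n$, the polynomial $T_k(B)$ is divisible by $\prod_{i=1}^t[d_i]!$ in $\mathbb Z[q]$. The quotient $T_k(B)/\prod_{i=1}^t[d_i]!$ is either zero or symmetric with darga $L_k(B)$, and, accordingly, $T_k(B)$ is either zero or symmetric with darga $N_k(B)$. If in addition either 1. $d_{i-1}+d_i\ge h_i$ for $1\le i\le t$, or 2. $D_i\ge H_i$ for $1\le i\le t$, then $T_k(B)/\prod_{i=1}^t[d_i]!$ is either zero, or has nonnegative coefficients and is symmetric and unimodal with darga $L_k(B)$. -/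

import Mathlib

open Polynomial

namespace QRook

/-- The partial sum `a 1 + ⋯ + a i` of a sequence indexed from `1` (so it is `0` for `i = 0`). -/
def psum (a : ℕ → ℕ) (i : ℕ) : ℕ := ∑ j ∈ Finset.Icc 1 i, a j

/-- The Ferrers board `B(h₁,d₁;…;h_t,d_t)`, as a finite set of squares `(row, column)`, both
numbered from `1`, with row `1` on top: the first `d₁` columns consist of the top `h₁` squares,
the next `d₂` columns of the top `h₁ + h₂` squares, and so on. -/
def board (t : ℕ) (h d : ℕ → ℕ) : Finset (ℕ × ℕ) :=
  (Finset.Icc 1 t).biUnion fun i =>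
    Finset.Icc 1 (psum h i) ×ˢ Finset.Ioc (psum d (i - 1)) (psum d i)

/-- No two rooks of `P` share a row or a column. -/
def NonAttacking (P : Finset (ℕ × ℕ)) : Prop :=
  ∀ r ∈ P, ∀ s ∈ P, r ≠ s → r.1 ≠ s.1 ∧ r.2 ≠ s.2

/-- The square `s` contains a rook of `P`, or is above or to the right of a rook of `P`. -/
def Crossed (P : Finset (ℕ × ℕ)) (s : ℕ × ℕ) : Prop :=
  ∃ r ∈ P, s = r ∨ (s.2 = r.2 ∧ s.1 < r.1) ∨ (s.1 = r.1 ∧ r.2 < s.2)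

open Classical in
/-- The number of squares of `B` that are not crossed out by the rooks of `P`. -/
noncomputable def inv (P B : Finset (ℕ × ℕ)) : ℕ := (B.filter fun s => ¬ Crossed P s).card

open Classical in
/-- The `q`-rook polynomial `R_k(B)`, where `q` is the variable of `ℤ[X]`. -/
noncomputable def rookPoly (B : Finset (ℕ × ℕ)) (k : ℕ) : ℤ[X] :=
  ∑ P ∈ (B.powersetCard k).filter NonAttacking, X ^ inv P B

/-- `[m] = 1 + q + ⋯ + q^(m-1)`. -/
noncomputable def qInt (m : ℕ) : ℤ[X] := ∑ i ∈ Finset.range m, X ^ i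

/-- `[m]! = [1][2]⋯[m]`. -/
noncomputable def qFact (m : ℕ) : ℤ[X] := ∏ i ∈ Finset.Icc 1 m, qInt i

/-- `∑_{k=0}^n [k]! R_{n-k}(B) ∏_{i=k+1}^n (x - q^i)`, a polynomial in `x` (outer variable)
whose coefficients are polynomials in `q` (inner variable). -/
noncomputable def hitGen (n : ℕ) (B : Finset (ℕ × ℕ)) : ℤ[X][X] :=
  ∑ k ∈ Finset.range (n + 1),
    C (qFact k * rookPoly B (n - k)) * ∏ i ∈ Finset.Icc (k + 1) n, (X - C (X ^ i))

/-- The `q`-hit polynomial `T_k(B)` of a board `B` with `n` columns. -/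
noncomputable def hitPoly (n : ℕ) (B : Finset (ℕ × ℕ)) (k : ℕ) : ℤ[X] := (hitGen n B).coeff k

/-- For `f = ∑_{j=M}^N a_j q^j` with `a_M, a_N ≠ 0`: `a_{M+j} = a_{N-j}` for `0 ≤ j ≤ N - M`. -/
def IsSymmetric (f : ℤ[X]) : Prop :=
  ∀ j ≤ f.natDegree - f.natTrailingDegree,
    f.coeff (f.natTrailingDegree + j) = f.coeff (f.natDegree - j)

/-- For `f = ∑_{j=M}^N a_j q^j` with `a_M, a_N ≠ 0`: there is `M ≤ p ≤ N` with
`a_M ≤ ⋯ ≤ a_p ≥ ⋯ ≥ a_N`. -/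
def IsUnimodal (f : ℤ[X]) : Prop :=
  ∃ p, f.natTrailingDegree ≤ p ∧ p ≤ f.natDegree ∧
    (∀ j, f.natTrailingDegree ≤ j → j < p → f.coeff j ≤ f.coeff (j + 1)) ∧
    (∀ j, p ≤ j → j < f.natDegree → f.coeff (j + 1) ≤ f.coeff j)

/-- `M + N` for `f = ∑_{j=M}^N a_j q^j` with `a_M, a_N ≠ 0` (used for nonzero `f` only). -/
noncomputable def darga (f : ℤ[X]) : ℕ := f.natTrailingDegree + f.natDegree

/-- `f` is zero, or has nonnegative coefficients and is symmetric and unimodal of darga `e`. -/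
def Zsu (f : ℤ[X]) (e : ℤ) : Prop :=
  f = 0 ∨ ((∀ j, 0 ≤ f.coeff j) ∧ IsSymmetric f ∧ IsUnimodal f ∧ (darga f : ℤ) = e)

/-- `L_k(B) = Area(B) + n(n-k) - ∑ D_i d_i` for `B = B(h₁,d₁;…;h_t,d_t)`, `n = D_t`. -/
def dargaL (t : ℕ) (h d : ℕ → ℕ) (k : ℕ) : ℤ :=
  ((board t h d).card : ℤ) + (psum d t : ℤ) * ((psum d t : ℤ) - (k : ℤ))
    - ∑ i ∈ Finset.Icc 1 t, (psum d i : ℤ) * (d i : ℤ)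

/-- `N_k(B) = Area(B) + n(n-k) - n(n+1)/2` for a board `B` with `n` columns. -/
def dargaN (n : ℕ) (B : Finset (ℕ × ℕ)) (k : ℕ) : ℤ :=
  (B.card : ℤ) + (n : ℤ) * ((n : ℤ) - (k : ℤ)) - (Nat.choose (n + 1) 2 : ℤ)

end QRook

namespace QRook

/-! The linear functional `X ^ m ↦ qBinom (x + m) n` sends `∏_{i>k} (X - q^i)` to `qBinom x k`.
Applied to the defining identity it gives `∑ T_m * qBinom (x + m) n = ∑ R_{n-k} [x]⋯[x-k+1]`
(`sum_hitPoly_mul_qBinom`). Adding columns one at a time factors the right side as `∏ [d_i]! *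
qBinom (x + H_i - D_{i-1}) (d_i)` (`rookSum_board`).

For `x = 0, …, n` these equations are unitriangular in `T_n, T_{n-1}, …`, so the factor `∏ [d_i]!`
passes to every `T_k` (`hitPoly_board_eq`). Gaussian binomials are symmetric with darga `k (n - k)`;
hence the remaining product has darga `n x + const`, and back substitution respects these dargas
(`expansionCoeff_mem_symmetricGroup`). This proves symmetry for all boards.

Back substitution involves signs, so unimodality needs another route. A `q`-Nanjundiah identity
(`qBinom_mul_qBinom_eq_sum`) re-expands a basis element times one more Gaussian binomial, with
coefficients that are powers of `q` times two Gaussian binomials. These are nonnegative, symmetric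
and unimodal by Sylvester's theorem, and all contributions to one coefficient have the same darga.
Conditions 1 and 2 keep the tops of these binomials nonnegative as blocks are added
(`exists_expansion_blockProd`). Uniqueness of the expansion identifies the result with the quotient.
-/

/-! ### Gaussian binomial identities. -/

theorem qInt_zero : qInt 0 = 0 := by simp [qInt]

theorem qInt_one : qInt 1 = 1 := by simp [qInt]

theorem qInt_succ (m : ℕ) : qInt (m + 1) = qInt m + X ^ m := by
  simp [qInt, Finset.sum_range_succ]

theorem qInt_add (a b : ℕ) : qInt (a + b) = qInt a + X ^ a * qInt b := by
  simp [qInt, Finset.sum_range_add, pow_add, Finset.mul_sum]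

theorem qInt_ne_zero {m : ℕ} (hm : 0 < m) : qInt m ≠ 0 := by
  intro h
  have := congrArg (eval 1) h
  simp [qInt, eval_finsetSum] at this
  omega

theorem qFact_zero : qFact 0 = 1 := by simp [qFact]

theorem qFact_succ (m : ℕ) : qFact (m + 1) = qFact m * qInt (m + 1) := by
  simp [qFact, Finset.prod_Icc_succ_top]

theorem qFact_ne_zero (m : ℕ) : qFact m ≠ 0 := by
  refine Finset.prod_ne_zero_iff.2 fun i hi => qInt_ne_zero ?_
  simp at hi; omega

/-- The Gaussian binomial coefficient, defined by the `q`-Pascal recursion. -/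
noncomputable def qBinom : ℕ → ℕ → ℤ[X]
  | _, 0 => 1
  | 0, _ + 1 => 0
  | n + 1, k + 1 => qBinom n k + X ^ (k + 1) * qBinom n (k + 1)

@[simp] theorem qBinom_zero_right (n : ℕ) : qBinom n 0 = 1 := by
  cases n <;> rfl

@[simp] theorem qBinom_zero_succ (k : ℕ) : qBinom 0 (k + 1) = 0 := rfl

theorem qBinom_succ_succ (n k : ℕ) :
    qBinom (n + 1) (k + 1) = qBinom n k + X ^ (k + 1) * qBinom n (k + 1) := rfl

theorem qBinom_eq_zero {n k : ℕ} (h : n < k) : qBinom n k = 0 := by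
  induction n generalizing k with
  | zero => obtain ⟨k, rfl⟩ := Nat.exists_eq_succ_of_ne_zero h.ne'; rfl
  | succ n ih =>
    obtain ⟨k, rfl⟩ := Nat.exists_eq_succ_of_ne_zero (Nat.ne_zero_of_lt h)
    rw [Nat.succ_eq_add_one, qBinom_succ_succ, ih (by omega), ih (by omega)]
    simp

@[simp] theorem qBinom_self (n : ℕ) : qBinom n n = 1 := by
  induction n with
  | zero => rfl
  | succ n ih => rw [qBinom_succ_succ, ih, qBinom_eq_zero (Nat.lt_succ_self n)]; simp

/-- No bound `k ≤ n` is needed: for `k > n` truncated subtraction puts the factor `[0] = 0` in the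
product. -/
theorem qBinom_mul_qFact (n k : ℕ) :
    qBinom n k * qFact k = ∏ i ∈ Finset.range k, qInt (n - i) := by
  induction n generalizing k with
  | zero =>
    cases k with
    | zero => simp [qFact_zero]
    | succ k => simp [qInt_zero]
  | succ n ih =>
    cases k with
    | zero => simp [qFact_zero]
    | succ k =>
      have h1 := ih k
      have h2 := ih (k + 1)
      rw [Finset.prod_range_succ, ← h1] at h2
      rw [Finset.prod_range_succ']
      simp only [Nat.add_sub_add_right, Nat.sub_zero]
      rw [← h1, qBinom_succ_succ, add_mul, mul_assoc, h2]
      rcases le_or_gt k n with h | h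
      · have : qInt (n + 1) = qInt (k + 1) + X ^ (k + 1) * qInt (n - k) := by
          rw [← qInt_add]; congr 1; omega
        rw [this, qFact_succ]; ring
      · rw [qBinom_eq_zero h]; ring

theorem qBinom_mul_qFact_mul_qFact (a b : ℕ) :
    qBinom (a + b) a * qFact a * qFact b = qFact (a + b) := by
  rw [qBinom_mul_qFact]
  induction a with
  | zero => simp
  | succ a ih =>
    rw [Finset.prod_range_succ', Nat.succ_add, qFact_succ, ← ih]
    simp only [Nat.add_sub_add_right, Nat.sub_zero, Nat.succ_eq_add_one]
    ring

theorem qBinom_symm (a b : ℕ) : qBinom (a + b) a = qBinom (a + b) b := by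
  have h1 := qBinom_mul_qFact_mul_qFact a b
  have h2 := qBinom_mul_qFact_mul_qFact b a
  rw [add_comm b a, ← h1] at h2
  refine mul_right_cancel₀ (mul_ne_zero (qFact_ne_zero a) (qFact_ne_zero b)) ?_
  linear_combination -h2

theorem qBinom_mul_qBinom_add (a b c : ℕ) :
    qBinom (a + b + c) (a + b) * qBinom (a + b) a =
      qBinom (a + b + c) a * qBinom (b + c) b := by
  have h1 := qBinom_mul_qFact_mul_qFact (a + b) c
  have h2 := qBinom_mul_qFact_mul_qFact a b
  have h3 := qBinom_mul_qFact_mul_qFact a (b + c)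
  have h4 := qBinom_mul_qFact_mul_qFact b c
  rw [← add_assoc] at h3
  refine mul_right_cancel₀ (mul_ne_zero (qFact_ne_zero a)
    (mul_ne_zero (qFact_ne_zero b) (qFact_ne_zero c))) ?_
  calc _ = qBinom (a + b + c) (a + b) * (qBinom (a + b) a * qFact a * qFact b) * qFact c := by ring
    _ = qBinom (a + b + c) a * qFact a * (qBinom (b + c) b * qFact b * qFact c) := by
      rw [h2, h1, h4, h3]
    _ = _ := by ring

theorem qBinom_mul_qBinom (n a b : ℕ) :
    qBinom n (a + b) * qBinom (a + b) a = qBinom n a * qBinom (n - a) b := by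
  rcases le_or_gt (a + b) n with h | h
  · obtain ⟨c, rfl⟩ := Nat.exists_eq_add_of_le h
    rw [qBinom_mul_qBinom_add]; congr 2; omega
  · rw [qBinom_eq_zero h, zero_mul]
    rcases lt_or_ge n a with h' | h'
    · rw [qBinom_eq_zero h', zero_mul]
    · rw [qBinom_eq_zero (show n - a < b by omega), mul_zero]

/-- The `q`-Vandermonde identity. -/
theorem qBinom_add (a b n : ℕ) :
    qBinom (a + b) n = ∑ p ∈ Finset.HasAntidiagonal.antidiagonal n,
      X ^ (p.2 * (a - p.1)) * qBinom a p.1 * qBinom b p.2 := by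
  induction a generalizing n with
  | zero =>
    cases n with
    | zero => simp
    | succ n => simp [Finset.Nat.sum_antidiagonal_succ]
  | succ a ih =>
    cases n with
    | zero => simp
    | succ n =>
      rw [Nat.succ_add, qBinom_succ_succ, ih n, ih (n + 1), Finset.Nat.sum_antidiagonal_succ,
        Finset.Nat.sum_antidiagonal_succ, mul_add, ← add_assoc, add_comm (Finset.sum _ _),
        add_assoc, Finset.mul_sum, ← Finset.sum_add_distrib]
      congr 1
      · simp only [Nat.sub_zero, qBinom_zero_right]
        rw [show (n + 1) * (a + 1) = (n + 1) + (n + 1) * a by ring, pow_add]; ring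
      · refine Finset.sum_congr rfl fun p hp => ?_
        have hp : p.1 + p.2 = n := by simpa using hp
        simp only [Nat.add_sub_add_right, qBinom_succ_succ]
        rcases le_or_gt (p.1 + 1) a with h | h
        · obtain ⟨c, hc⟩ := Nat.exists_eq_add_of_le h
          have e1 : a - p.1 = c + 1 := by omega
          have e2 : a - (p.1 + 1) = c := by omega
          rw [e1, e2, ← hp]
          ring
        · rw [qBinom_eq_zero h]; ring

/-- Vandermonde with the terms `k > K` dropped, since they vanish; writing `k = K - p.2` removes the
truncated subtraction from the exponent. -/
theorem qBinom_add_add (K w M : ℕ) :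
    qBinom (K + w) (K + M) = ∑ p ∈ Finset.HasAntidiagonal.antidiagonal K,
      X ^ ((M + p.2) * p.2) * qBinom K p.1 * qBinom w (M + p.2) := by
  rw [qBinom_add, Finset.Nat.sum_antidiagonal_eq_sum_range_succ_mk,
    Finset.Nat.sum_antidiagonal_eq_sum_range_succ_mk]
  symm
  refine (Finset.sum_congr rfl fun k hk => ?_).trans
    (Finset.sum_subset (Finset.range_mono (by omega)) fun k _ hk => ?_)
  · have : K + M - k = M + (K - k) := by
      simp at hk; omega
    simp only [this]
  · simp at hk
    rw [qBinom_eq_zero (n := K) (k := k) (by omega)]; simp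

/-- The `q`-analogue of Nanjundiah's identity. -/
theorem qBinom_mul_qBinom_eq_sum {a b m n : ℕ} (h : a + b = m + n) (u : ℕ) :
    qBinom (m + u) m * qBinom (a + u) n = ∑ p ∈ Finset.HasAntidiagonal.antidiagonal n,
      X ^ (p.2 * (a - p.1)) * qBinom a p.1 * qBinom b p.2 * qBinom (p.1 + (m + u)) (m + n) := by
  -- Vandermonde splits `qBinom (a + u) n`; the trinomial identity then trades `qBinom (m + u) m *
  -- qBinom u i` for `qBinom (m + u) (m + i) * qBinom (m + i) m`. Since `m + i = b + (a - k)`,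
  -- Vandermonde applies to the last factor too.
  have L : qBinom (m + u) m * qBinom (a + u) n = ∑ p ∈ Finset.HasAntidiagonal.antidiagonal n,
      ∑ s ∈ Finset.HasAntidiagonal.antidiagonal p.2, X ^ (p.2 * (a - p.1) + s.1 * (b - s.2)) *
        (qBinom a p.1 * qBinom (a - p.1) s.1) * qBinom b s.2 * qBinom (m + u) (m + p.2) := by
    rw [qBinom_add a u, Finset.mul_sum]
    refine Finset.sum_congr rfl fun p hp => ?_
    have hp : p.1 + p.2 = n := by simpa using hp
    rcases le_or_gt p.1 a with hpa | hpa
    · have e := qBinom_mul_qBinom (m + u) m p.2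
      rw [Nat.add_sub_cancel_left] at e
      have e2 : qBinom (m + p.2) m = ∑ s ∈ Finset.HasAntidiagonal.antidiagonal p.2,
          X ^ (s.1 * (b - s.2)) * qBinom b s.2 * qBinom (a - p.1) s.1 := by
        rw [qBinom_symm, show m + p.2 = b + (a - p.1) by omega, qBinom_add,
          ← Finset.Nat.sum_antidiagonal_swap]
        simp
      calc _ = X ^ (p.2 * (a - p.1)) * qBinom a p.1 * (qBinom (m + u) m * qBinom u p.2) := by ring
        _ = _ := by
          rw [← e, e2, Finset.mul_sum, Finset.mul_sum]
          refine Finset.sum_congr rfl fun s _ => ?_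
          rw [pow_add]; ring
    · rw [qBinom_eq_zero hpa]; simp
  have R : ∀ p ∈ Finset.HasAntidiagonal.antidiagonal n,
      X ^ (p.2 * (a - p.1)) * qBinom a p.1 * qBinom b p.2 * qBinom (p.1 + (m + u)) (m + n) =
      ∑ s ∈ Finset.HasAntidiagonal.antidiagonal p.1, X ^ (p.2 * (a - p.1) + (m + p.2 + s.2) * s.2) *
        (qBinom a p.1 * qBinom p.1 s.1) * qBinom b p.2 * qBinom (m + u) (m + p.2 + s.2) := by
    intro p hp
    have hp : p.1 + p.2 = n := by simpa using hp
    rw [show m + n = p.1 + (m + p.2) by omega, qBinom_add_add, Finset.mul_sum]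
    refine Finset.sum_congr rfl fun s _ => ?_
    rw [pow_add]; ring
  rw [L, Finset.sum_congr rfl R, Finset.sum_sigma', Finset.sum_sigma']
  -- On the left `k` and `r` are chosen in succession out of `a`; on the right `k + r` is chosen
  -- first and `k` out of it. The trinomial identity matches the two.
  refine Finset.sum_bij' (fun x _ => ⟨(x.1.1 + x.2.1, x.2.2), (x.1.1, x.2.1)⟩)
    (fun x _ => ⟨(x.2.1, x.2.2 + x.1.2), (x.2.2, x.1.2)⟩) ?_ ?_ ?_ ?_ ?_
  · rintro ⟨⟨k, i⟩, ⟨r, p⟩⟩ hx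
    simp at hx ⊢; omega
  · rintro ⟨⟨k, i⟩, ⟨r, p⟩⟩ hx
    simp at hx ⊢; omega
  · rintro ⟨⟨k, i⟩, ⟨r, p⟩⟩ hx
    simp at hx ⊢; omega
  · rintro ⟨⟨k, i⟩, ⟨r, p⟩⟩ hx
    simp at hx ⊢; omega
  · rintro ⟨⟨k, i⟩, ⟨r, p⟩⟩ hx
    simp only [Finset.mem_sigma, Finset.HasAntidiagonal.mem_antidiagonal] at hx ⊢
    obtain ⟨h1, rfl⟩ := hx
    rw [qBinom_mul_qBinom]
    -- Out-of-range terms vanish on both sides; in the rest all subtractions are genuine and the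
    -- exponents can be compared.
    rcases lt_or_ge b p with hb | hb
    · rw [qBinom_eq_zero hb]; ring
    rcases lt_or_ge a k with hk | hk
    · rw [qBinom_eq_zero hk]; ring
    rcases lt_or_ge (a - k) r with hr | hr
    · rw [qBinom_eq_zero hr]; ring
    obtain ⟨b, rfl⟩ := Nat.exists_eq_add_of_le hb
    obtain ⟨a', rfl⟩ := Nat.exists_eq_add_of_le (show k + r ≤ a by omega)
    have hm : m = a' + b := by omega
    subst hm
    rw [show k + r + a' - k = r + a' by omega, show k + r + a' - (k + r) = a' by omega,
      show p + b - p = b by omega, show a' + b + p + r = a' + b + (r + p) by ring]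
    congr 4
    ring

/-! ### Symmetric and unimodal polynomials as combinations of strings. -/

/-- The strings `q^a + ⋯ + q^(e-a)`, the building blocks of symmetric unimodal polynomials of
darga `e`. -/
def strings (e : ℤ) : Set ℤ[X] :=
  {f | ∃ a m : ℕ, 2 * (a : ℤ) + m = e + 1 ∧ f = X ^ a * qInt m}

/-- Nonnegative combinations of strings of darga `e`. -/
noncomputable def unimodalCone (e : ℤ) : AddSubmonoid ℤ[X] := AddSubmonoid.closure (strings e)

/-- Integral combinations of strings of darga `e`. -/
noncomputable def symmetricGroup (e : ℤ) : AddSubgroup ℤ[X] := AddSubgroup.closure (strings e)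

theorem unimodalCone_le (e : ℤ) : unimodalCone e ≤ (symmetricGroup e).toAddSubmonoid :=
  AddSubmonoid.closure_le.2 AddSubgroup.subset_closure

theorem X_pow_mul_qInt_mem {a m : ℕ} {e : ℤ} (h : 2 * (a : ℤ) + m = e + 1) :
    X ^ a * qInt m ∈ unimodalCone e :=
  AddSubmonoid.subset_closure ⟨a, m, h, rfl⟩

/-- Clebsch–Gordan: `[m+1][n+1] = [m+n+1] + q [m][n]`, and the last product is again centred at the
same place. -/
theorem qInt_mul_qInt_mem (c m n : ℕ) :
    X ^ c * (qInt m * qInt n) ∈ unimodalCone (2 * c + m + n - 2) := by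
  induction m generalizing n c with
  | zero => simp [qInt_zero]
  | succ m ih =>
    cases n with
    | zero => simp [qInt_zero]
    | succ n =>
      have h1 := qInt_add m (n + 1)
      have h2 := qInt_add 1 m
      have h3 := qInt_add 1 n
      rw [add_comm 1 m, qInt_one, pow_one] at h2
      rw [add_comm 1 n, qInt_one, pow_one] at h3
      have h4 := qInt_succ m
      have : X ^ c * (qInt (m + 1) * qInt (n + 1)) =
          X ^ c * qInt (m + (n + 1)) + X ^ (c + 1) * (qInt m * qInt n) := by
        rw [h1, pow_succ]
        linear_combination X ^ c * (qInt m * h3 + qInt (n + 1) * h4)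
      rw [this]
      refine add_mem (X_pow_mul_qInt_mem (by push_cast; ring)) ?_
      convert ih (c + 1) n using 2
      push_cast; ring

theorem strings_mul_strings {e e' : ℤ} {f g : ℤ[X]} (hf : f ∈ strings e) (hg : g ∈ strings e') :
    f * g ∈ unimodalCone (e + e') := by
  obtain ⟨a, m, h, rfl⟩ := hf
  obtain ⟨b, n, h', rfl⟩ := hg
  rw [show X ^ a * qInt m * (X ^ b * qInt n) = X ^ (a + b) * (qInt m * qInt n) by ring,
    show e + e' = 2 * ((a + b : ℕ) : ℤ) + m + n - 2 by push_cast; linarith]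
  exact qInt_mul_qInt_mem (a + b) m n

theorem mul_mem_unimodalCone {e e' : ℤ} {f g : ℤ[X]} (hf : f ∈ unimodalCone e)
    (hg : g ∈ unimodalCone e') : f * g ∈ unimodalCone (e + e') := by
  induction hf using AddSubmonoid.closure_induction with
  | zero => simp
  | add x y _ _ hx hy => rw [add_mul]; exact add_mem hx hy
  | mem x hx =>
    induction hg using AddSubmonoid.closure_induction with
    | zero => simp
    | add u v _ _ hu hv => rw [mul_add]; exact add_mem hu hv
    | mem u hu => exact strings_mul_strings hx hu

theorem mul_mem_symmetricGroup {e e' : ℤ} {f g : ℤ[X]} (hf : f ∈ symmetricGroup e)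
    (hg : g ∈ symmetricGroup e') : f * g ∈ symmetricGroup (e + e') := by
  induction hf using AddSubgroup.closure_induction with
  | zero => simp
  | add x y _ _ hx hy => rw [add_mul]; exact add_mem hx hy
  | neg x _ hx => rw [neg_mul]; exact neg_mem hx
  | mem x hx =>
    induction hg using AddSubgroup.closure_induction with
    | zero => simp
    | add u v _ _ hu hv => rw [mul_add]; exact add_mem hu hv
    | neg u _ hu => rw [mul_neg]; exact neg_mem hu
    | mem u hu => exact unimodalCone_le _ (strings_mul_strings hx hu)

theorem one_mem_unimodalCone : (1 : ℤ[X]) ∈ unimodalCone 0 := by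
  simpa [qInt_one] using X_pow_mul_qInt_mem (a := 0) (m := 1) (e := 0) (by norm_num)

theorem X_pow_mem_unimodalCone (a : ℕ) : (X ^ a : ℤ[X]) ∈ unimodalCone (2 * a) := by
  simpa [qInt_one] using X_pow_mul_qInt_mem (a := a) (m := 1) (e := 2 * a) (by norm_num)

theorem qFact_mem_unimodalCone (m : ℕ) : qFact m ∈ unimodalCone (m.choose 2) := by
  induction m with
  | zero => simpa [qFact_zero] using one_mem_unimodalCone
  | succ m ih =>
    rw [qFact_succ]
    have h := mul_mem_unimodalCone ih
      (X_pow_mul_qInt_mem (a := 0) (m := m + 1) (e := m) (by push_cast; ring))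
    rw [pow_zero, one_mul] at h
    rwa [Nat.choose_succ_succ' m 1, Nat.choose_one_right, Nat.cast_add, add_comm (m : ℤ)]

theorem prod_mem_unimodalCone {ι : Type*} (s : Finset ι) (f : ι → ℤ[X]) (e : ι → ℤ)
    (h : ∀ i ∈ s, f i ∈ unimodalCone (e i)) : ∏ i ∈ s, f i ∈ unimodalCone (∑ i ∈ s, e i) := by
  classical
  induction s using Finset.induction_on with
  | empty => simpa using one_mem_unimodalCone
  | insert a s ha ih =>
    rw [Finset.prod_insert ha, Finset.sum_insert ha]
    exact mul_mem_unimodalCone (h a (by simp)) (ih fun i hi => h i (by simp [hi]))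

theorem coeff_string (a m j : ℕ) :
    (X ^ a * qInt m).coeff j = if a ≤ j ∧ j < a + m then 1 else 0 := by
  rw [coeff_X_pow_mul', qInt, finsetSum_coeff]
  simp only [coeff_X_pow, Finset.sum_ite_eq, Finset.mem_range]
  split_ifs <;> first | rfl | omega

theorem coeff_eq_coeff_of_mem {e : ℤ} {f : ℤ[X]} (hf : f ∈ symmetricGroup e) {i j : ℕ}
    (h : (i : ℤ) + j = e) : f.coeff i = f.coeff j := by
  induction hf using AddSubgroup.closure_induction with
  | zero => rfl
  | add x y _ _ hx hy => rw [coeff_add, coeff_add, hx, hy]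
  | neg x _ hx => rw [coeff_neg, coeff_neg, hx]
  | mem x hx =>
    obtain ⟨a, m, ha, rfl⟩ := hx
    rw [coeff_string, coeff_string]
    congr 1
    apply propext
    omega

theorem coeff_eq_zero_of_mem {e : ℤ} {f : ℤ[X]} (hf : f ∈ symmetricGroup e) {i : ℕ}
    (h : e < i) : f.coeff i = 0 := by
  induction hf using AddSubgroup.closure_induction with
  | zero => rfl
  | add x y _ _ hx hy => rw [coeff_add, hx, hy, add_zero]
  | neg x _ hx => rw [coeff_neg, hx, neg_zero]
  | mem x hx =>
    obtain ⟨a, m, ha, rfl⟩ := hx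
    rw [coeff_string, if_neg]
    omega

theorem coeff_nonneg_of_mem {e : ℤ} {f : ℤ[X]} (hf : f ∈ unimodalCone e) (i : ℕ) :
    0 ≤ f.coeff i := by
  induction hf using AddSubmonoid.closure_induction with
  | zero => simp
  | add x y _ _ hx hy => rw [coeff_add]; exact add_nonneg hx hy
  | mem x hx =>
    obtain ⟨a, m, ha, rfl⟩ := hx
    rw [coeff_string]
    split_ifs <;> simp

theorem coeff_le_coeff_of_mem {e : ℤ} {f : ℤ[X]} (hf : f ∈ unimodalCone e) {i : ℕ}
    (hi : 2 * (i : ℤ) < e) : f.coeff i ≤ f.coeff (i + 1) := by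
  induction hf using AddSubmonoid.closure_induction with
  | zero => simp
  | add x y _ _ hx hy => rw [coeff_add, coeff_add]; exact add_le_add hx hy
  | mem x hx =>
    obtain ⟨a, m, ha, rfl⟩ := hx
    rw [coeff_string, coeff_string]
    split_ifs <;> omega

/-- The reflection `i ↦ e - i` preserves the set of exponents with nonzero coefficient, so it
exchanges the lowest and the highest. -/
theorem darga_eq_of_mem {e : ℤ} {f : ℤ[X]} (hf : f ∈ symmetricGroup e) (h0 : f ≠ 0) :
    (darga f : ℤ) = e := by
  have hN : f.coeff f.natDegree ≠ 0 := by simpa using h0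
  have hM : f.coeff f.natTrailingDegree ≠ 0 := trailingCoeff_nonzero_iff_nonzero.2 h0
  have hNe : (f.natDegree : ℤ) ≤ e := by
    by_contra! h; exact hN (coeff_eq_zero_of_mem hf h)
  have hMN := natTrailingDegree_le_natDegree f
  obtain ⟨E, rfl⟩ : ∃ E : ℕ, e = E := ⟨e.toNat, by omega⟩
  have h1 : f.coeff (E - f.natDegree) ≠ 0 := by
    rwa [← coeff_eq_coeff_of_mem hf (i := f.natDegree) (by omega)]
  have h2 : f.coeff (E - f.natTrailingDegree) ≠ 0 := by
    rwa [← coeff_eq_coeff_of_mem hf (i := f.natTrailingDegree) (by omega)]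
  have h3 := natTrailingDegree_le_of_ne_zero h1
  have h4 := le_natDegree_of_ne_zero h2
  simp only [darga]
  omega

theorem isSymmetric_of_mem {e : ℤ} {f : ℤ[X]} (hf : f ∈ symmetricGroup e) : IsSymmetric f := by
  intro j hj
  rcases eq_or_ne f 0 with rfl | h0
  · simp
  have h := darga_eq_of_mem hf h0
  have hMN := natTrailingDegree_le_natDegree f
  simp only [darga] at h
  exact coeff_eq_coeff_of_mem hf (by omega)

theorem zsu_of_mem {e : ℤ} {f : ℤ[X]} (hf : f ∈ unimodalCone e) : Zsu f e := by
  rcases eq_or_ne f 0 with h0 | h0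
  · exact Or.inl h0
  have hs := unimodalCone_le e hf
  have hd := darga_eq_of_mem hs h0
  refine Or.inr ⟨coeff_nonneg_of_mem hf, isSymmetric_of_mem hs, ?_, hd⟩
  have hMN := natTrailingDegree_le_natDegree f
  simp only [darga] at hd
  -- The peak is at half the darga, rounded down; the descent beyond it is the reflected ascent.
  refine ⟨(f.natTrailingDegree + f.natDegree) / 2, by omega, by omega, fun j _ hj => ?_,
    fun j hj hj' => ?_⟩
  · exact coeff_le_coeff_of_mem hf (by omega)
  · obtain ⟨i, hi⟩ : ∃ i, f.natTrailingDegree + f.natDegree = j + 1 + i :=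
      ⟨f.natTrailingDegree + f.natDegree - j - 1, by omega⟩
    rw [coeff_eq_coeff_of_mem hs (i := j + 1) (j := i) (by omega),
      coeff_eq_coeff_of_mem hs (i := j) (j := i + 1) (by omega)]
    exact coeff_le_coeff_of_mem hf (by omega)

/-- A symmetric polynomial with nonnegative coefficients that increase up to the middle is a
nonnegative combination of strings. -/
theorem mem_unimodalCone {e : ℕ} {f : ℤ[X]} (h0 : 0 ≤ f.coeff 0)
    (hdeg : ∀ i, e < i → f.coeff i = 0) (hsymm : ∀ i j, i + j = e → f.coeff i = f.coeff j)
    (hmono : ∀ i, 2 * i < e → f.coeff i ≤ f.coeff (i + 1)) : f ∈ unimodalCone e := by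
  induction e using Nat.strong_induction_on generalizing f with
  | _ e ih =>
  have key : ∀ g : ℤ[X], f = f.coeff 0 • qInt (e + 1) + X * g → X * g ∈ unimodalCone e →
      f ∈ unimodalCone e := by
    intro g hg hm
    rw [hg]
    refine add_mem ?_ hm
    obtain ⟨c, hc⟩ := Int.eq_ofNat_of_zero_le h0
    rw [hc, natCast_zsmul]
    refine nsmul_mem ?_ c
    simpa using X_pow_mul_qInt_mem (a := 0) (m := e + 1) (e := e) (by push_cast; ring)
  have hq : ∀ j, (qInt (e + 1)).coeff j = if j ≤ e then 1 else 0 := fun j => by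
    have := coeff_string 0 (e + 1) j
    simpa [Nat.lt_succ_iff] using this
  -- Subtracting the full string `a_0 [e+1]` leaves a multiple of `q` whose quotient satisfies the
  -- same hypotheses with `e - 2`. For `e < 2` nothing is left.
  set g := (f - f.coeff 0 • qInt (e + 1)).divX with hgdef
  have hg : f = f.coeff 0 • qInt (e + 1) + X * g := by
    have := X_mul_divX_add (f - f.coeff 0 • qInt (e + 1))
    rw [← hgdef] at this
    simp only [coeff_sub, coeff_smul, hq] at this
    simp at this
    linear_combination -this
  have hgc : ∀ j, g.coeff j = f.coeff (j + 1) - if j + 1 ≤ e then f.coeff 0 else 0 := fun j => by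
    rw [hgdef, coeff_divX, coeff_sub, coeff_smul, hq]
    split_ifs <;> simp
  refine key g hg ?_
  have hlast : f.coeff 0 = f.coeff e := hsymm 0 e (by omega)
  rcases Nat.lt_or_ge e 2 with he | he
  · have : g = 0 := by
      ext j
      rw [hgc, coeff_zero]
      split_ifs with hj
      · have : j + 1 = e := by omega
        rw [this, hlast, sub_self]
      · rw [hdeg _ (by omega), sub_zero]
    rw [this, mul_zero]
    exact zero_mem _
  · have hmem : g ∈ unimodalCone ((e - 2 : ℕ) : ℤ) := by
      refine ih (e - 2) (by omega) ?_ ?_ ?_ ?_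
      · rw [hgc, if_pos (by omega)]
        have := hmono 0 (by omega)
        simpa using this
      · intro i hi
        rw [hgc]
        split_ifs with h
        · have : i + 1 = e := by omega
          rw [this, hlast, sub_self]
        · rw [hdeg _ (by omega), sub_zero]
      · intro i j hij
        rw [hgc, hgc, if_pos (by omega), if_pos (by omega), hsymm (i + 1) (j + 1) (by omega)]
      · intro i hi
        rw [hgc, hgc, if_pos (by omega), if_pos (by omega)]
        exact sub_le_sub_right (hmono _ (by omega)) _
    have := mul_mem_unimodalCone (X_pow_mem_unimodalCone 1) hmem
    rw [pow_one] at this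
    convert this using 2
    push_cast [he]; ring

/-! ### Sylvester's theorem through an `sl₂` action on monomials. -/

theorem qBinom_add_one_add_one (k n : ℕ) :
    qBinom (k + 1 + (n + 1)) (k + 1) =
      qBinom (k + 1 + n) (k + 1) + X ^ (n + 1) * qBinom (k + (n + 1)) k := by
  rw [qBinom_symm, ← add_assoc, qBinom_succ_succ, qBinom_symm (k + 1) n, qBinom_symm k (n + 1)]
  congr 3
  omega

/-- `qBinom (k + n) k` enumerates the monomials of degree `k` in `x_0, …, x_n` by weight. -/
theorem sum_finsuppAntidiag_eq_qBinom (n k : ℕ) :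
    ∑ s ∈ Finset.finsuppAntidiag (Finset.range (n + 1)) k,
      (X : ℤ[X]) ^ (∑ j ∈ Finset.range (n + 1), j * s j) = qBinom (k + n) k := by
  -- `g j` is the geometric series `1 / (1 - q^j T)`, and `hg1` is its functional equation.
  set g : ℕ → PowerSeries ℤ[X] := fun j => PowerSeries.mk fun a => X ^ (j * a) with hg
  have hg1 : ∀ j, g j = 1 + PowerSeries.C (X ^ j) * (PowerSeries.X * g j) := by
    intro j
    ext1 a
    cases a with
    | zero => simp [hg]
    | succ a =>
      rw [map_add, PowerSeries.coeff_C_mul, PowerSeries.coeff_succ_X_mul, PowerSeries.coeff_one]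
      simp [hg, mul_add, pow_add, mul_comm]
  have hsum : ∑ s ∈ Finset.finsuppAntidiag (Finset.range (n + 1)) k,
      (X : ℤ[X]) ^ (∑ j ∈ Finset.range (n + 1), j * s j) =
      PowerSeries.coeff k (∏ j ∈ Finset.range (n + 1), g j) := by
    rw [PowerSeries.coeff_prod]
    simp only [hg, PowerSeries.coeff_mk, Finset.prod_pow_eq_pow_sum]
  rw [hsum]
  clear hsum
  induction n generalizing k with
  | zero => simp [hg]
  | succ n ih =>
    have hrec : ∏ j ∈ Finset.range (n + 1 + 1), g j = ∏ j ∈ Finset.range (n + 1), g j +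
        PowerSeries.C (X ^ (n + 1)) *
          (PowerSeries.X * ∏ j ∈ Finset.range (n + 1 + 1), g j) := by
      rw [Finset.prod_range_succ]
      linear_combination (∏ j ∈ Finset.range (n + 1), g j) * hg1 (n + 1)
    induction k with
    | zero => rw [hrec, map_add, ih]; simp
    | succ k ihk =>
      rw [hrec, map_add, ih, PowerSeries.coeff_C_mul, PowerSeries.coeff_succ_X_mul, ihk,
        qBinom_add_one_add_one]

/-- If `E v = 0` in weight `i`, then `E F^(m+1) v = (m+1)(2i - N - m) F^m v`, and this scalar is
nonzero because `2i < N`. Thus `F^m v = 0` forces `v = 0`, and `F^m v` does vanish once the weight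
`i - m` is negative. -/
theorem eq_zero_of_raising_eq_zero {M : Type*} [AddCommGroup M] [Module ℚ M]
    (E F : M →ₗ[ℚ] M) (V : ℤ → Submodule ℚ M) (N : ℤ) (hneg : ∀ i < 0, V i = ⊥)
    (hF : ∀ i, ∀ v ∈ V i, F v ∈ V (i - 1))
    (hEF : ∀ i, ∀ v ∈ V i, E (F v) - F (E v) = ((2 * i - N : ℤ) : ℚ) • v)
    {i : ℤ} (hi : 2 * i < N) {v : M} (hv : v ∈ V i) (hE : E v = 0) : v = 0 := by
  have hFm : ∀ m : ℕ, (F ^ m) v ∈ V (i - m) := by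
    intro m
    induction m with
    | zero => simpa using hv
    | succ m ih =>
      rw [pow_succ', Module.End.mul_apply]
      convert hF _ _ ih using 2
      push_cast; ring
  have hEFm : ∀ m : ℕ, E ((F ^ (m + 1)) v) =
      (((m + 1) * (2 * i - N - m) : ℤ) : ℚ) • (F ^ m) v := by
    intro m
    induction m with
    | zero => simpa [hE] using hEF _ _ hv
    | succ m ih =>
      have h := hEF _ _ (hFm (m + 1))
      rw [ih, map_smul, ← Module.End.mul_apply F, ← pow_succ', sub_eq_iff_eq_add,
        ← Module.End.mul_apply F, ← pow_succ', ← add_smul] at h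
      rw [h]
      congr 1
      push_cast; ring
  have hdown : ∀ m : ℕ, (F ^ m) v = 0 → v = 0 := by
    intro m
    induction m with
    | zero => simp
    | succ m ih =>
      intro h
      have h' := hEFm m
      rw [h, map_zero, eq_comm, smul_eq_zero] at h'
      refine ih (h'.resolve_left ?_)
      rw [Int.cast_eq_zero]
      exact mul_ne_zero (by omega) (by omega)
  refine hdown (i.toNat + 1) ?_
  have := hFm (i.toNat + 1)
  rwa [hneg _ (by omega), Submodule.mem_bot] at this

/-- The exponents of the monomials of degree `k` and weight `i` in `x_0, …, x_n`, where `x_j` has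
weight `j`. -/
noncomputable def weightExponents (n k : ℕ) (i : ℤ) : Finset (ℕ →₀ ℕ) :=
  (Finset.finsuppAntidiag (Finset.range (n + 1)) k).filter
    fun s => ((∑ j ∈ Finset.range (n + 1), j * s j : ℕ) : ℤ) = i

/-- The span of the monomials of degree `k` and weight `i` in `x_0, …, x_n`. -/
noncomputable def weightSpace (n k : ℕ) (i : ℤ) : Submodule ℚ (MvPolynomial ℕ ℚ) :=
  Submodule.span ℚ (Set.range fun s : weightExponents n k i => MvPolynomial.monomial (s : ℕ →₀ ℕ) 1)

theorem finrank_weightSpace (n k : ℕ) (i : ℤ) :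
    Module.finrank ℚ (weightSpace n k i) = (weightExponents n k i).card := by
  rw [weightSpace, finrank_span_eq_card]
  · simp
  · have := (MvPolynomial.basisMonomials ℕ ℚ).linearIndependent
    rw [MvPolynomial.coe_basisMonomials] at this
    exact this.comp _ Subtype.val_injective

instance (n k : ℕ) (i : ℤ) : FiniteDimensional ℚ (weightSpace n k i) :=
  FiniteDimensional.span_of_finite ℚ (Set.finite_range _)

theorem monomial_mem_weightSpace {n k : ℕ} {i : ℤ} {s : ℕ →₀ ℕ} (hs : s ∈ weightExponents n k i)
    (c : ℚ) : MvPolynomial.monomial s c ∈ weightSpace n k i := by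
  rw [← mul_one c, ← smul_eq_mul, ← MvPolynomial.smul_monomial]
  exact Submodule.smul_mem _ _ (Submodule.subset_span ⟨⟨s, hs⟩, rfl⟩)

theorem mem_weightExponents {n k : ℕ} {i : ℤ} {s : ℕ →₀ ℕ} :
    s ∈ weightExponents n k i ↔ (∑ j ∈ Finset.range (n + 1), s j = k ∧
      s.support ⊆ Finset.range (n + 1)) ∧ ((∑ j ∈ Finset.range (n + 1), j * s j : ℕ) : ℤ) = i := by
  rw [weightExponents, Finset.mem_filter, Finset.mem_finsuppAntidiag]

theorem add_single_mem_weightExponents {n k : ℕ} {i i' : ℤ} {s : ℕ →₀ ℕ} {j j' : ℕ} (hj : j ≤ n)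
    (hj' : j' ≤ n) (hs : s + Finsupp.single j 1 ∈ weightExponents n k i)
    (h : i' = i - j + j') : s + Finsupp.single j' 1 ∈ weightExponents n k i' := by
  rw [mem_weightExponents] at hs ⊢
  have hsum : ∀ l ≤ n, ∑ x ∈ Finset.range (n + 1), (Finsupp.single l 1 : ℕ →₀ ℕ) x = 1 := by
    intro l hl
    simp [Finsupp.single_apply, hl]
  have hwt : ∀ l ≤ n, ∑ x ∈ Finset.range (n + 1), x * (Finsupp.single l 1 : ℕ →₀ ℕ) x = l := by
    intro l hl
    simp [Finsupp.single_apply, hl]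
  simp only [Finsupp.add_apply, mul_add, Finset.sum_add_distrib, hsum j hj, hsum j' hj', hwt j hj,
    hwt j' hj'] at hs ⊢
  refine ⟨⟨hs.1.1, fun x hx => ?_⟩, by push_cast at hs ⊢; omega⟩
  rcases Finset.mem_union.1 (Finsupp.support_add hx) with hx | hx
  · refine hs.1.2 ?_
    rw [Finsupp.mem_support_iff] at hx ⊢
    simp [hx]
  · have := Finsupp.support_single_subset hx
    simp at this ⊢
    omega

open MvPolynomial in
/-- The derivation with `x_j ↦ c_j x_{f j}`. -/
noncomputable def shiftDerivation (c : ℕ → ℚ) (f : ℕ → ℕ) :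
    Derivation ℚ (MvPolynomial ℕ ℚ) (MvPolynomial ℕ ℚ) :=
  mkDerivation ℚ fun j => c j • X (f j)

theorem shiftDerivation_monomial (c : ℕ → ℚ) (f : ℕ → ℕ) (s : ℕ →₀ ℕ) :
    shiftDerivation c f (MvPolynomial.monomial s 1) = ∑ j ∈ s.support,
      MvPolynomial.monomial (s - Finsupp.single j 1 + Finsupp.single (f j) 1) (s j * c j) := by
  rw [shiftDerivation, MvPolynomial.mkDerivation_monomial, one_smul, Finsupp.sum]
  refine Finset.sum_congr rfl fun j _ => ?_
  rw [smul_eq_mul, MvPolynomial.X, MvPolynomial.smul_monomial, MvPolynomial.monomial_mul]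
  simp

/-- The condition is asked only where `c j ≠ 0`: this exempts the end variables `x_n` and `x_0`,
which raising and lowering kill. -/
theorem shiftDerivation_mem {n k : ℕ} {c : ℕ → ℚ} {f : ℕ → ℕ} {i i' : ℤ}
    (h : ∀ j ≤ n, c j ≠ 0 → f j ≤ n ∧ i' = i - j + f j) {v : MvPolynomial ℕ ℚ}
    (hv : v ∈ weightSpace n k i) : shiftDerivation c f v ∈ weightSpace n k i' := by
  induction hv using Submodule.span_induction with
  | zero => simp
  | add x y _ _ hx hy => rw [map_add]; exact add_mem hx hy
  | smul a x _ hx => rw [Derivation.map_smul]; exact Submodule.smul_mem _ _ hx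
  | mem x hx =>
    obtain ⟨⟨s, hs⟩, rfl⟩ := hx
    simp only
    rw [shiftDerivation_monomial]
    refine Submodule.sum_mem _ fun j hj => ?_
    rcases eq_or_ne (c j) 0 with hc | hc
    · simp [hc]
    have hjn : j ≤ n := by
      have := (mem_weightExponents.1 hs).1.2 hj
      simp at this; omega
    obtain ⟨h1, h2⟩ := h j hjn hc
    refine monomial_mem_weightSpace (add_single_mem_weightExponents hjn h1 ?_ h2) _
    rwa [tsub_add_cancel_of_le]
    rw [Finsupp.single_le_iff]
    exact Nat.one_le_iff_ne_zero.2 (Finsupp.mem_support_iff.1 hj)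

theorem shiftDerivation_id_apply {n k : ℕ} {i : ℤ} {v : MvPolynomial ℕ ℚ}
    (hv : v ∈ weightSpace n k i) : shiftDerivation (fun j => 2 * j - n) id v =
      ((2 * i - n * k : ℤ) : ℚ) • v := by
  induction hv using Submodule.span_induction with
  | zero => simp
  | add x y _ _ hx hy => rw [map_add, hx, hy, smul_add]
  | smul a x _ hx => rw [Derivation.map_smul, hx, smul_comm]
  | mem x hx =>
    obtain ⟨⟨s, hs⟩, rfl⟩ := hx
    simp only
    have hs' := mem_weightExponents.1 hs
    have hterm : ∀ j ∈ s.support, (MvPolynomial.monomial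
        (s - Finsupp.single j 1 + Finsupp.single (id j) 1) ((s j : ℚ) * (2 * j - n)) :
          MvPolynomial ℕ ℚ) = MvPolynomial.monomial s ((s j : ℚ) * (2 * j - n)) := by
      intro j hj
      rw [id_eq, tsub_add_cancel_of_le]
      rw [Finsupp.single_le_iff]
      exact Nat.one_le_iff_ne_zero.2 (Finsupp.mem_support_iff.1 hj)
    rw [shiftDerivation_monomial, Finset.sum_congr rfl hterm, ← map_sum,
      MvPolynomial.smul_monomial, smul_eq_mul, mul_one]
    congr 1
    rw [Finset.sum_subset hs'.1.2 fun j _ hj => by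
      rw [Finsupp.notMem_support_iff.1 hj]; simp]
    rw [← hs'.2, ← hs'.1.1]
    push_cast
    rw [Finset.mul_sum, Finset.mul_sum, ← Finset.sum_sub_distrib]
    exact Finset.sum_congr rfl fun j _ => by ring

/-- Both sides are derivations, so it suffices to compare them on variables, where `j (n - j + 1) -
(n - j)(j + 1) = 2j - n`. -/
theorem shiftDerivation_commutator (n : ℕ) (v : MvPolynomial ℕ ℚ) :
    shiftDerivation (fun j => n - j) (· + 1) (shiftDerivation (fun j => j) (· - 1) v) -
      shiftDerivation (fun j => j) (· - 1) (shiftDerivation (fun j => n - j) (· + 1) v) =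
      shiftDerivation (fun j => 2 * j - n) id v := by
  rw [← Derivation.commutator_apply]
  refine congrArg (fun D : Derivation ℚ _ _ => D v) (MvPolynomial.derivation_ext fun j => ?_)
  rw [Derivation.commutator_apply]
  simp only [shiftDerivation, MvPolynomial.mkDerivation_X, Derivation.map_smul]
  cases j with
  | zero => simp
  | succ j =>
    simp only [Nat.add_sub_cancel, smul_smul, ← sub_smul, id]
    congr 1
    push_cast; ring

/-- The raising operator is injective on weight spaces below the middle, whose dimensions are these
cardinalities. -/
theorem card_weightExponents_le (n k : ℕ) {i : ℤ} (hi : 2 * i < n * k) :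
    (weightExponents n k i).card ≤ (weightExponents n k (i + 1)).card := by
  set E : MvPolynomial ℕ ℚ →ₗ[ℚ] MvPolynomial ℕ ℚ :=
    (shiftDerivation (fun j => n - j) (· + 1)).toLinearMap with hE
  set F : MvPolynomial ℕ ℚ →ₗ[ℚ] MvPolynomial ℕ ℚ :=
    (shiftDerivation (fun j => j) (· - 1)).toLinearMap with hF
  have hEmem : ∀ v ∈ weightSpace n k i, E v ∈ weightSpace n k (i + 1) := fun v hv =>
    shiftDerivation_mem (fun j hj hc => by
      have : j ≠ n := by rintro rfl; simp at hc
      exact ⟨by omega, by push_cast; ring⟩) hv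
  have hFmem : ∀ i, ∀ v ∈ weightSpace n k i, F v ∈ weightSpace n k (i - 1) := fun i v hv =>
    shiftDerivation_mem (fun j hj hc => by
      have : j ≠ 0 := by rintro rfl; simp at hc
      exact ⟨by omega, by omega⟩) hv
  have hneg : ∀ i < 0, weightSpace n k i = ⊥ := by
    intro i hi
    rw [weightSpace, Submodule.span_eq_bot]
    rintro _ ⟨⟨s, hs⟩, rfl⟩
    have := (mem_weightExponents.1 hs).2
    omega
  have hcomm : ∀ i, ∀ v ∈ weightSpace n k i,
      E (F v) - F (E v) = ((2 * i - (n * k : ℤ) : ℤ) : ℚ) • v := fun i v hv =>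
    (shiftDerivation_commutator n v).trans (shiftDerivation_id_apply hv)
  rw [← finrank_weightSpace, ← finrank_weightSpace]
  refine LinearMap.finrank_le_finrank_of_injective (f := E.restrict hEmem) ?_
  rw [← LinearMap.ker_eq_bot, LinearMap.ker_eq_bot']
  rintro ⟨v, hv⟩ h
  have h' : E v = 0 := congrArg Subtype.val h
  exact Subtype.ext
    (eq_zero_of_raising_eq_zero E F (weightSpace n k) _ hneg hFmem hcomm hi hv h')

theorem coeff_qBinom (n k i : ℕ) :
    (qBinom (k + n) k).coeff i = (weightExponents n k i).card := by
  rw [← sum_finsuppAntidiag_eq_qBinom, finsetSum_coeff, weightExponents, Finset.card_filter]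
  push_cast
  refine Finset.sum_congr rfl fun s _ => ?_
  rw [coeff_X_pow]
  congr 1
  apply propext
  rw [eq_comm]
  norm_cast

theorem coeff_qBinom_le (n k : ℕ) {i : ℕ} (hi : 2 * i < k * n) :
    (qBinom (k + n) k).coeff i ≤ (qBinom (k + n) k).coeff (i + 1) := by
  rw [coeff_qBinom, coeff_qBinom]
  have := card_weightExponents_le n k (i := i) (by rw [mul_comm (n : ℤ)]; exact_mod_cast hi)
  exact_mod_cast this

/-- The reflection `i ↦ k n - i` interchanges the two forms of the `q`-Pascal recursion term by
term. -/
theorem qBinom_symmetric (k n : ℕ) :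
    (∀ i, k * n < i → (qBinom (k + n) k).coeff i = 0) ∧
    ∀ i j, i + j = k * n → (qBinom (k + n) k).coeff i = (qBinom (k + n) k).coeff j := by
  induction k generalizing n with
  | zero => simp [coeff_one]; omega
  | succ k ihk =>
    induction n with
    | zero => simp [coeff_one]; omega
    | succ n ihn =>
      have h1 : qBinom (k + 1 + (n + 1)) (k + 1) =
          qBinom (k + (n + 1)) k + X ^ (k + 1) * qBinom (k + 1 + n) (k + 1) := by
        rw [show k + 1 + (n + 1) = k + (n + 1) + 1 by ring, qBinom_succ_succ,
          show k + (n + 1) = k + 1 + n by ring]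
      have h2 := qBinom_add_one_add_one k n
      obtain ⟨a1, a2⟩ := ihk (n + 1)
      obtain ⟨b1, b2⟩ := ihn
      have e : (k + 1) * (n + 1) = k * (n + 1) + (n + 1) := by ring
      have e' : (k + 1) * (n + 1) = (k + 1) * n + (k + 1) := by ring
      constructor
      · intro i hi
        rw [h1, coeff_add, coeff_X_pow_mul', a1 i (by omega), zero_add]
        split_ifs
        · exact b1 _ (by omega)
        · rfl
      · intro i j hij
        rw [h1, coeff_add, coeff_X_pow_mul', ← h1, h2, coeff_add, coeff_X_pow_mul', add_comm]
        congr 1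
        · split_ifs
          · exact b2 _ _ (by omega)
          · exact (b1 _ (by omega)).symm
        · split_ifs
          · exact a2 _ _ (by omega)
          · exact a1 _ (by omega)

theorem qBinom_add_mem_unimodalCone (k n : ℕ) : qBinom (k + n) k ∈ unimodalCone (k * n) := by
  have h := mem_unimodalCone (e := k * n) (f := qBinom (k + n) k)
    (by rw [coeff_qBinom]; positivity)
    (qBinom_symmetric k n).1 (qBinom_symmetric k n).2 fun i hi => coeff_qBinom_le n k hi
  exact_mod_cast h

/-- The theorem of Sylvester: Gaussian binomial coefficients are symmetric and unimodal. -/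
theorem qBinom_mem_unimodalCone (n k : ℕ) : qBinom n k ∈ unimodalCone (k * (n - k : ℤ)) := by
  rcases le_or_gt k n with h | h
  · obtain ⟨m, rfl⟩ := Nat.exists_eq_add_of_le h
    convert qBinom_add_mem_unimodalCone k m using 2
    push_cast; ring
  · rw [qBinom_eq_zero h]; exact zero_mem _

/-! ### Rook placements and the removal of the last column. -/

/-- Sums over the row of a rook in the last column: as `r` runs over the free rows, the number of
free rows below `r` takes each value `0, …, |A| - 1` once. -/
theorem sum_X_pow_card_filter_lt (A : Finset ℕ) :
    ∑ r ∈ A, (X : ℤ[X]) ^ (A.filter (r < ·)).card = qInt A.card := by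
  induction A using Finset.induction_on_min with
  | empty => simp [qInt_zero]
  | insert a A ha ih =>
    have hna : a ∉ A := fun h => lt_irrefl a (ha a h)
    rw [Finset.sum_insert hna, Finset.card_insert_of_notMem hna, qInt_succ, ← ih, add_comm]
    congr 1
    · refine Finset.sum_congr rfl fun r hr => ?_
      rw [Finset.filter_insert, if_neg (ha r hr).not_gt]
    · rw [Finset.filter_insert, if_neg (lt_irrefl a), Finset.filter_true_of_mem ha]

theorem NonAttacking.mono {P Q : Finset (ℕ × ℕ)} (hQ : NonAttacking Q) (h : P ⊆ Q) :
    NonAttacking P := fun r hr s hs hrs => hQ r (h hr) s (h hs) hrs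

theorem NonAttacking.card_image_fst {P : Finset (ℕ × ℕ)} (hP : NonAttacking P) :
    (P.image Prod.fst).card = P.card :=
  Finset.card_image_of_injOn fun r hr s hs h => by
    by_contra hne; exact (hP r hr s hs hne).1 h

theorem NonAttacking.card_image_snd {P : Finset (ℕ × ℕ)} (hP : NonAttacking P) :
    (P.image Prod.snd).card = P.card :=
  Finset.card_image_of_injOn fun r hr s hs h => by
    by_contra hne; exact (hP r hr s hs hne).2 h

theorem rookPoly_eq_zero_of_rows {B : Finset (ℕ × ℕ)} {c k : ℕ}
    (hB : ∀ s ∈ B, s.1 ∈ Finset.Icc 1 c) (hk : c < k) : rookPoly B k = 0 := by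
  classical
  refine Finset.sum_eq_zero fun P hP => ?_
  rw [Finset.mem_filter, Finset.mem_powersetCard] at hP
  have h1 := Finset.card_le_card (Finset.image_subset_iff.2 fun s hs => hB s (hP.1.1 hs))
  rw [hP.2.card_image_fst, hP.1.2, Nat.card_Icc] at h1
  omega

theorem rookPoly_eq_zero_of_cols {B : Finset (ℕ × ℕ)} {n k : ℕ}
    (hB : ∀ s ∈ B, s.2 ∈ Finset.Icc 1 n) (hk : n < k) : rookPoly B k = 0 := by
  classical
  refine Finset.sum_eq_zero fun P hP => ?_
  rw [Finset.mem_filter, Finset.mem_powersetCard] at hP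
  have h1 := Finset.card_le_card (Finset.image_subset_iff.2 fun s hs => hB s (hP.1.1 hs))
  rw [hP.2.card_image_snd, hP.1.2, Nat.card_Icc] at h1
  omega

section AddColumn

variable {B : Finset (ℕ × ℕ)} {n c : ℕ}

theorem disjoint_column (hcol : ∀ s ∈ B, s.2 ∈ Finset.Icc 1 n) :
    Disjoint B (Finset.Icc 1 c ×ˢ {n + 1}) := by
  rw [Finset.disjoint_left]
  intro s hs hs'
  have := hcol s hs
  simp only [Finset.mem_product, Finset.mem_singleton, Finset.mem_Icc] at this hs'
  omega

/-- All rooks lie to the left of the new column, so they cross out exactly its squares in their own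
rows. -/
theorem inv_union_column (hcol : ∀ s ∈ B, s.2 ∈ Finset.Icc 1 n)
    {P : Finset (ℕ × ℕ)} (hP : P ⊆ B) :
    inv P (B ∪ Finset.Icc 1 c ×ˢ {n + 1}) =
      inv P B + (Finset.Icc 1 c \ P.image Prod.fst).card := by
  classical
  unfold inv
  rw [Finset.filter_union, Finset.card_union_of_disjoint
    (Finset.disjoint_filter_filter (disjoint_column hcol))]
  congr 1
  refine Finset.card_bij' (fun s _ => s.1) (fun r _ => (r, n + 1)) ?_ ?_ ?_ ?_
  · rintro ⟨r, j⟩ h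
    simp only [Finset.mem_filter, Finset.mem_product, Finset.mem_singleton] at h
    obtain ⟨⟨hr, rfl⟩, hc⟩ := h
    rw [Finset.mem_sdiff, Finset.mem_image]
    refine ⟨hr, ?_⟩
    rintro ⟨s, hs, rfl⟩
    have := hcol s (hP hs)
    simp at this
    exact hc ⟨s, hs, Or.inr (Or.inr ⟨rfl, by simp; omega⟩)⟩
  · intro r h
    rw [Finset.mem_sdiff, Finset.mem_image] at h
    simp only [Finset.mem_filter, Finset.mem_product, Finset.mem_singleton, and_true]
    refine ⟨h.1, ?_⟩
    rintro ⟨s, hs, hc⟩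
    have := hcol s (hP hs)
    simp at this
    rcases hc with hc | hc | hc
    · subst hc; simp at this
    · have := hc.1; simp at this; omega
    · exact h.2 ⟨s, hs, hc.1.symm⟩
  · rintro ⟨r, j⟩ h
    simp only [Finset.mem_filter, Finset.mem_product, Finset.mem_singleton] at h
    simp [h.1.2]
  · intro r _; rfl

/-- The new rook crosses out nothing in `B`; in its own column only the free rows strictly below it
survive. -/
theorem inv_insert_union_column (hcol : ∀ s ∈ B, s.2 ∈ Finset.Icc 1 n)
    {P : Finset (ℕ × ℕ)} (hP : P ⊆ B) (r : ℕ) :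
    inv (insert (r, n + 1) P) (B ∪ Finset.Icc 1 c ×ˢ {n + 1}) =
      inv P B + ((Finset.Icc 1 c \ P.image Prod.fst).filter (r < ·)).card := by
  classical
  unfold inv
  rw [Finset.filter_union, Finset.card_union_of_disjoint
    (Finset.disjoint_filter_filter (disjoint_column hcol))]
  congr 1
  · congr 1
    refine Finset.filter_congr fun s hs => not_congr ?_
    have := hcol s hs
    simp at this
    constructor
    · rintro ⟨x, hx, hc⟩
      rcases Finset.mem_insert.1 hx with rfl | hx
      · exfalso
        rcases hc with rfl | hc | hc
        · simp at this
        · have := hc.1; simp at this; omega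
        · have := hc.2; simp at this; omega
      · exact ⟨x, hx, hc⟩
    · rintro ⟨x, hx, hc⟩
      exact ⟨x, Finset.mem_insert_of_mem hx, hc⟩
  refine Finset.card_bij' (fun s _ => s.1) (fun r _ => (r, n + 1)) ?_ ?_ ?_ ?_
  · rintro ⟨r', j⟩ h
    simp only [Finset.mem_filter, Finset.mem_product, Finset.mem_singleton] at h
    obtain ⟨⟨hr, rfl⟩, hc⟩ := h
    rw [Finset.mem_filter, Finset.mem_sdiff, Finset.mem_image]
    refine ⟨⟨hr, ?_⟩, ?_⟩
    · rintro ⟨s, hs, rfl⟩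
      have := hcol s (hP hs)
      simp at this
      exact hc ⟨s, Finset.mem_insert_of_mem hs, Or.inr (Or.inr ⟨rfl, by simp; omega⟩)⟩
    · by_contra! hle
      refine hc ⟨_, Finset.mem_insert_self _ _, ?_⟩
      rcases hle.eq_or_lt with h | h
      · left; simp at h; simp [h]
      · right; left; simpa using h
  · intro r' h
    rw [Finset.mem_filter, Finset.mem_sdiff, Finset.mem_image] at h
    simp only [Finset.mem_filter, Finset.mem_product, Finset.mem_singleton, and_true]
    refine ⟨h.1.1, ?_⟩
    rintro ⟨s, hs, hc⟩
    rcases Finset.mem_insert.1 hs with rfl | hs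
    · simp at hc
      omega
    have := hcol s (hP hs)
    simp at this
    rcases hc with hc | hc | hc
    · subst hc; simp at this
    · have := hc.1; simp at this; omega
    · exact h.1.2 ⟨s, hs, hc.1.symm⟩
  · rintro ⟨r', j⟩ h
    simp only [Finset.mem_filter, Finset.mem_product, Finset.mem_singleton] at h
    simp [h.1.2]
  · intro r' _; rfl

theorem card_Icc_sdiff_image_fst (hrow : ∀ s ∈ B, s.1 ∈ Finset.Icc 1 c)
    {P : Finset (ℕ × ℕ)} (hP : P ⊆ B) (hP' : NonAttacking P) :
    (Finset.Icc 1 c \ P.image Prod.fst).card = c - P.card := by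
  rw [Finset.card_sdiff_of_subset (Finset.image_subset_iff.2 fun s hs => hrow s (hP hs)),
    hP'.card_image_fst, Nat.card_Icc, Nat.add_sub_cancel]

theorem nonAttacking_insert (hcol : ∀ s ∈ B, s.2 ∈ Finset.Icc 1 n)
    {P : Finset (ℕ × ℕ)} (hP : P ⊆ B) (hP' : NonAttacking P) {r : ℕ}
    (hr : r ∉ P.image Prod.fst) : NonAttacking (insert (r, n + 1) P) := by
  have key : ∀ s ∈ P, s.1 ≠ r ∧ s.2 ≠ n + 1 := by
    intro s hs
    have := hcol s (hP hs)
    simp at this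
    exact ⟨fun h => hr (Finset.mem_image.2 ⟨s, hs, h⟩), by omega⟩
  intro x hx y hy hxy
  rcases Finset.mem_insert.1 hx with rfl | hx <;> rcases Finset.mem_insert.1 hy with rfl | hy
  · exact absurd rfl hxy
  · exact ⟨(key y hy).1.symm, (key y hy).2.symm⟩
  · exact key x hx
  · exact hP' x hx y hy hxy

theorem rookPoly_union_column_zero (hcol : ∀ s ∈ B, s.2 ∈ Finset.Icc 1 n) :
    rookPoly (B ∪ Finset.Icc 1 c ×ˢ {n + 1}) 0 = X ^ c * rookPoly B 0 := by
  classical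
  have h0 : NonAttacking ∅ := fun r hr => absurd hr (Finset.notMem_empty r)
  simp only [rookPoly, Finset.powersetCard_zero, Finset.filter_singleton, if_pos h0,
    Finset.sum_singleton]
  rw [inv_union_column hcol (Finset.empty_subset _), pow_add, mul_comm]
  simp

/-- The recursion obtained by deleting the last column of a Ferrers board. -/
theorem rookPoly_union_column_succ (hcol : ∀ s ∈ B, s.2 ∈ Finset.Icc 1 n)
    (hrow : ∀ s ∈ B, s.1 ∈ Finset.Icc 1 c) (k : ℕ) :
    rookPoly (B ∪ Finset.Icc 1 c ×ˢ {n + 1}) (k + 1) =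
      X ^ (c - (k + 1)) * rookPoly B (k + 1) + qInt (c - k) * rookPoly B k := by
  classical
  unfold rookPoly
  -- The two terms count the placements without and with a rook in the last column.
  rw [← Finset.sum_filter_add_sum_filter_not _ (fun P => P ⊆ B)]
  congr 1
  · rw [Finset.mul_sum]
    refine Finset.sum_congr ?_ fun P hP => ?_
    · ext P
      simp only [Finset.mem_filter, Finset.mem_powersetCard]
      exact ⟨fun h => ⟨⟨h.2, h.1.1.2⟩, h.1.2⟩,
        fun h => ⟨⟨⟨h.1.1.trans Finset.subset_union_left, h.1.2⟩, h.2⟩, h.1.1⟩⟩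
    · rw [Finset.mem_filter, Finset.mem_powersetCard] at hP
      rw [inv_union_column hcol hP.1.1, card_Icc_sdiff_image_fst hrow hP.1.1 hP.2, hP.1.2, pow_add,
        mul_comm]
  · have hR : qInt (c - k) * ∑ P ∈ (B.powersetCard k).filter NonAttacking, X ^ inv P B =
        ∑ P ∈ (B.powersetCard k).filter NonAttacking, ∑ r ∈ Finset.Icc 1 c \ P.image Prod.fst,
          X ^ inv (insert (r, n + 1) P) (B ∪ Finset.Icc 1 c ×ˢ {n + 1}) := by
      rw [Finset.mul_sum]
      refine Finset.sum_congr rfl fun P hP => ?_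
      rw [Finset.mem_filter, Finset.mem_powersetCard] at hP
      rw [← hP.1.2, ← card_Icc_sdiff_image_fst hrow hP.1.1 hP.2, ← sum_X_pow_card_filter_lt,
        Finset.sum_mul]
      refine Finset.sum_congr rfl fun r _ => ?_
      rw [inv_insert_union_column hcol hP.1.1, pow_add, mul_comm]
    rw [hR, Finset.sum_sigma']
    symm
    have hnot : ∀ (P : Finset (ℕ × ℕ)) (r : ℕ), P ⊆ B → (r, n + 1) ∉ P := by
      intro P r hP h
      have := hcol _ (hP h)
      simp at this
    refine Finset.sum_bij (fun x _ => insert (x.2, n + 1) x.1) ?_ ?_ ?_ fun _ _ => rfl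
    · rintro ⟨P, r⟩ h
      simp only [Finset.mem_sigma, Finset.mem_filter, Finset.mem_powersetCard,
        Finset.mem_sdiff] at h ⊢
      obtain ⟨⟨⟨hPB, hPk⟩, hP⟩, hr, hr'⟩ := h
      refine ⟨⟨⟨?_, ?_⟩, nonAttacking_insert hcol hPB hP hr'⟩, ?_⟩
      · refine Finset.insert_subset (Finset.mem_union_right _ ?_)
          (hPB.trans Finset.subset_union_left)
        simp only [Finset.mem_product, Finset.mem_singleton, and_true]
        exact hr
      · rw [Finset.card_insert_of_notMem (hnot P r hPB), hPk]
      · intro h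
        exact hnot B r subset_rfl (h (Finset.mem_insert_self _ _))
    · rintro ⟨P, r⟩ h ⟨P', r'⟩ h' heq
      simp only [Finset.mem_sigma, Finset.mem_filter, Finset.mem_powersetCard] at h h'
      simp only at heq
      have hr : r = r' := by
        have : (r, n + 1) ∈ insert (r', n + 1) P' := heq ▸ Finset.mem_insert_self _ _
        rcases Finset.mem_insert.1 this with h1 | h1
        · simpa using h1
        · exact absurd h1 (hnot P' r h'.1.1.1)
      subst hr
      have hPP : P = P' := by
        rw [← Finset.erase_insert (hnot P r h.1.1.1), heq,
          Finset.erase_insert (hnot P' r h'.1.1.1)]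
      subst hPP
      rfl
    · intro Q hQ
      simp only [Finset.mem_filter, Finset.mem_powersetCard] at hQ
      obtain ⟨⟨⟨hQB, hQk⟩, hQ⟩, hnB⟩ := hQ
      obtain ⟨⟨r, j⟩, hs, hsB⟩ := Finset.not_subset.1 hnB
      have hs' := (Finset.mem_union.1 (hQB hs)).resolve_left hsB
      simp only [Finset.mem_product, Finset.mem_singleton] at hs'
      obtain ⟨hr, rfl⟩ := hs'
      have hsub : Q.erase (r, n + 1) ⊆ B := by
        intro s hs1
        have hs2 := Finset.mem_erase.1 hs1
        refine (Finset.mem_union.1 (hQB hs2.2)).resolve_right fun h => ?_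
        simp only [Finset.mem_product, Finset.mem_singleton] at h
        exact (hQ s hs2.2 _ hs hs2.1).2 h.2
      refine ⟨⟨Q.erase (r, n + 1), r⟩, ?_, Finset.insert_erase hs⟩
      simp only [Finset.mem_sigma, Finset.mem_filter, Finset.mem_powersetCard, Finset.mem_sdiff,
        Finset.mem_image]
      refine ⟨⟨⟨hsub, ?_⟩, hQ.mono (Finset.erase_subset _ _)⟩, hr, ?_⟩
      · rw [Finset.card_erase_of_mem hs, hQk, Nat.add_sub_cancel]
      · rintro ⟨s, hs1, hs3⟩
        have hs2 := Finset.mem_erase.1 hs1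
        exact (hQ s hs2.2 _ hs hs2.1).1 hs3

end AddColumn

/-! ### The factorization theorem. -/

/-- The left-hand side `∑ R_{n-k}(B) [x][x-1]⋯[x-k+1]` of the factorization theorem. -/
noncomputable def rookSum (n : ℕ) (B : Finset (ℕ × ℕ)) (x : ℕ) : ℤ[X] :=
  ∑ p ∈ Finset.HasAntidiagonal.antidiagonal n,
    rookPoly B p.1 * ∏ i ∈ Finset.range p.2, qInt (x - i)

/-- Each rook number contributes through `[c-k] + q^(c-k) [x-(n-k)] = [x+c-n]`, whose right side
does not depend on `k`. -/
theorem rookSum_union_column {B : Finset (ℕ × ℕ)} {n c : ℕ}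
    (hcol : ∀ s ∈ B, s.2 ∈ Finset.Icc 1 n) (hrow : ∀ s ∈ B, s.1 ∈ Finset.Icc 1 c) (x : ℕ) :
    rookSum (n + 1) (B ∪ Finset.Icc 1 c ×ˢ {n + 1}) x = rookSum n B x * qInt (x + c - n) := by
  set g : ℕ → ℤ[X] := fun k => ∏ i ∈ Finset.range k, qInt (x - i) with hg
  have h1 : rookSum (n + 1) (B ∪ Finset.Icc 1 c ×ˢ {n + 1}) x =
      ∑ p ∈ Finset.HasAntidiagonal.antidiagonal (n + 1), X ^ (c - p.1) * rookPoly B p.1 * g p.2 +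
      ∑ p ∈ Finset.HasAntidiagonal.antidiagonal n, qInt (c - p.1) * rookPoly B p.1 * g p.2 := by
    rw [rookSum, Finset.Nat.sum_antidiagonal_succ, Finset.Nat.sum_antidiagonal_succ,
      rookPoly_union_column_zero hcol, Nat.sub_zero, add_assoc, ← Finset.sum_add_distrib]
    congr 1
    refine Finset.sum_congr rfl fun p _ => ?_
    rw [rookPoly_union_column_succ hcol hrow, add_mul]
  rw [h1, Finset.Nat.sum_antidiagonal_succ', rookPoly_eq_zero_of_cols hcol (Nat.lt_succ_self n),
    mul_zero, zero_mul, zero_add, ← Finset.sum_add_distrib, rookSum, Finset.sum_mul]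
  refine Finset.sum_congr rfl fun p hp => ?_
  have hp : p.1 + p.2 = n := by simpa using hp
  -- Where a subtraction would truncate, the rook polynomial or the falling product is already zero.
  rcases lt_or_ge c p.1 with h | h
  · rw [rookPoly_eq_zero_of_rows hrow h]; ring
  have hgs : g (p.2 + 1) = g p.2 * qInt (x - p.2) := by simp [hg, Finset.prod_range_succ]
  rcases lt_or_ge x p.2 with h' | h'
  · have : g p.2 = 0 := Finset.prod_eq_zero (Finset.mem_range.2 h') (by simp [qInt_zero])
    change _ = rookPoly B p.1 * g p.2 * _
    rw [hgs, this]; ring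
  · have : qInt (x + c - n) = qInt (c - p.1) + X ^ (c - p.1) * qInt (x - p.2) := by
      rw [← qInt_add]; congr 1; omega
    change _ = rookPoly B p.1 * g p.2 * _
    rw [hgs, this]; ring

/-- Columns of equal height contribute consecutive `q`-integers; this is the source of the factor
`[d_i]!`. -/
theorem rookSum_union_block {B : Finset (ℕ × ℕ)} {n c : ℕ}
    (hcol : ∀ s ∈ B, s.2 ∈ Finset.Icc 1 n) (hrow : ∀ s ∈ B, s.1 ∈ Finset.Icc 1 c) (x e : ℕ) :
    rookSum (n + e) (B ∪ Finset.Icc 1 c ×ˢ Finset.Ioc n (n + e)) x =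
      rookSum n B x * (qBinom (x + c - n) e * qFact e) := by
  rw [qBinom_mul_qFact]
  induction e with
  | zero => simp
  | succ e ih =>
    have hunion : B ∪ Finset.Icc 1 c ×ˢ Finset.Ioc n (n + (e + 1)) =
        (B ∪ Finset.Icc 1 c ×ˢ Finset.Ioc n (n + e)) ∪ Finset.Icc 1 c ×ˢ {n + e + 1} := by
      ext ⟨r, j⟩
      simp only [Finset.mem_union, Finset.mem_product, Finset.mem_Icc, Finset.mem_Ioc,
        Finset.mem_singleton, or_assoc, ← and_or_left]
      exact or_congr_right (and_congr_right fun _ => by omega)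
    rw [hunion, ← add_assoc, rookSum_union_column, ih, Finset.prod_range_succ, mul_assoc,
      show x + c - (n + e) = x + c - n - e by omega]
    · intro s hs
      rcases Finset.mem_union.1 hs with hs | hs
      · have := hcol s hs; simp at this ⊢; omega
      · simp at hs ⊢; omega
    · intro s hs
      rcases Finset.mem_union.1 hs with hs | hs
      · exact hrow s hs
      · exact (Finset.mem_product.1 hs).1

/-! ### Hit polynomials as coordinates of the rook sum. -/

/-- The linear functional sending `X ^ m` to `qBinom (x + m) n`. -/
noncomputable def qBinomFunctional (n x : ℕ) : ℤ[X][X] →ₗ[ℤ[X]] ℤ[X] :=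
  Polynomial.lsum fun m => LinearMap.toSpanSingleton ℤ[X] ℤ[X] (qBinom (x + m) n)

theorem qBinomFunctional_apply (n x : ℕ) (p : ℤ[X][X]) :
    qBinomFunctional n x p = p.sum fun m a => a * qBinom (x + m) n := rfl

theorem qBinomFunctional_monomial (n x m : ℕ) (a : ℤ[X]) :
    qBinomFunctional n x (monomial m a) = a * qBinom (x + m) n := by
  rw [qBinomFunctional_apply, sum_monomial_index _ _ (by simp)]

theorem qBinomFunctional_X_mul (n x : ℕ) (p : ℤ[X][X]) :
    qBinomFunctional n x (X * p) = qBinomFunctional n (x + 1) p := by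
  induction p using Polynomial.induction_on' with
  | add p q hp hq => rw [mul_add, map_add, map_add, hp, hq]
  | monomial m a =>
    rw [X_mul_monomial, qBinomFunctional_monomial, qBinomFunctional_monomial]
    congr 2
    omega

/-- Multiplication by `X` shifts `x`, so removing the factor `X - q^(k+1)` is exactly one use of the
`q`-Pascal recursion. -/
theorem qBinomFunctional_prod (x k e : ℕ) :
    qBinomFunctional (k + e) x (∏ i ∈ Finset.Icc (k + 1) (k + e), (X - C (X ^ i))) =
      qBinom x k := by
  induction e generalizing k x with
  | zero =>
    have h := qBinomFunctional_monomial k x 0 1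
    rw [monomial_zero_one, one_mul] at h
    rw [Finset.Icc_eq_empty (by omega), Finset.prod_empty]
    exact h
  | succ e ih =>
    have hprod : ∏ i ∈ Finset.Icc (k + 1) (k + (e + 1)), (X - C (X ^ i) : ℤ[X][X]) =
        X * ∏ i ∈ Finset.Icc (k + 1 + 1) (k + 1 + e), (X - C (X ^ i)) -
        (X ^ (k + 1) : ℤ[X]) • ∏ i ∈ Finset.Icc (k + 1 + 1) (k + 1 + e), (X - C (X ^ i)) := by
      rw [← Finset.mul_prod_Ioc_eq_prod_Icc (by omega), smul_eq_C_mul, ← sub_mul,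
        show k + (e + 1) = k + 1 + e by ring, Finset.Icc_add_one_left_eq_Ioc]
    rw [hprod, map_sub, qBinomFunctional_X_mul, map_smul, show k + (e + 1) = k + 1 + e by ring, ih,
      ih, qBinom_succ_succ, smul_eq_mul, add_sub_cancel_right]

theorem sum_hitPoly_mul_qBinom (n : ℕ) (B : Finset (ℕ × ℕ)) (x : ℕ) :
    ∑ m ∈ Finset.range (n + 1), hitPoly n B m * qBinom (x + m) n = rookSum n B x := by
  have hdeg : (hitGen n B).natDegree < n + 1 := by
    rw [Nat.lt_succ_iff, hitGen]
    refine natDegree_sum_le_of_forall_le _ _ fun k _ => ?_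
    refine (natDegree_C_mul_le _ _).trans ((natDegree_prod_le _ _).trans ?_)
    refine (Finset.sum_le_sum fun i _ => natDegree_X_sub_C_le _).trans ?_
    simp
  calc _ = qBinomFunctional n x (hitGen n B) := by
        rw [qBinomFunctional_apply, sum_over_range' _ (by simp) _ hdeg]; rfl
    _ = rookSum n B x := by
        rw [hitGen, map_sum, rookSum, ← Finset.Nat.sum_antidiagonal_swap,
          Finset.Nat.sum_antidiagonal_eq_sum_range_succ_mk]
        refine Finset.sum_congr rfl fun k hk => ?_
        obtain ⟨e, rfl⟩ := Nat.exists_eq_add_of_le (Nat.lt_succ_iff.1 (Finset.mem_range.1 hk))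
        rw [← smul_eq_C_mul, map_smul, qBinomFunctional_prod, smul_eq_mul, ← qBinom_mul_qFact]
        simp only [Prod.swap_prod_mk]
        ring

/-! ### Boards built from blocks, and the dargas. -/

theorem psum_zero (a : ℕ → ℕ) : psum a 0 = 0 := by simp [psum]

theorem psum_succ (a : ℕ → ℕ) (i : ℕ) : psum a (i + 1) = psum a i + a (i + 1) := by
  simp [psum, Finset.sum_Icc_succ_top]

theorem board_zero (h d : ℕ → ℕ) : board 0 h d = ∅ := by simp [board]

theorem board_succ (t : ℕ) (h d : ℕ → ℕ) : board (t + 1) h d = board t h d ∪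
    Finset.Icc 1 (psum h (t + 1)) ×ˢ Finset.Ioc (psum d t) (psum d t + d (t + 1)) := by
  rw [board, board, ← Finset.insert_Icc_right_eq_Icc_add_one (by omega), Finset.biUnion_insert,
    Finset.union_comm, psum_succ d, Nat.add_sub_cancel]

theorem snd_mem_of_mem_board {t : ℕ} {h d : ℕ → ℕ} : ∀ s ∈ board t h d,
    s.2 ∈ Finset.Icc 1 (psum d t) := by
  induction t with
  | zero => simp [board_zero]
  | succ t ih =>
    intro s hs
    rw [board_succ, Finset.mem_union] at hs
    rw [psum_succ, Finset.mem_Icc]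
    rcases hs with hs | hs
    · have := Finset.mem_Icc.1 (ih s hs); omega
    · have := Finset.mem_Ioc.1 (Finset.mem_product.1 hs).2; omega

theorem fst_mem_of_mem_board {t : ℕ} {h d : ℕ → ℕ} : ∀ s ∈ board t h d,
    s.1 ∈ Finset.Icc 1 (psum h t) := by
  induction t with
  | zero => simp [board_zero]
  | succ t ih =>
    intro s hs
    rw [board_succ, Finset.mem_union] at hs
    rcases hs with hs | hs
    · have := Finset.mem_Icc.1 (ih s hs)
      rw [psum_succ, Finset.mem_Icc]; omega
    · exact (Finset.mem_product.1 hs).1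

theorem card_board (t : ℕ) (h d : ℕ → ℕ) :
    (board t h d).card = ∑ i ∈ Finset.Icc 1 t, psum h i * d i := by
  induction t with
  | zero => simp [board_zero]
  | succ t ih =>
    rw [board_succ, Finset.card_union_of_disjoint, ih, Finset.sum_Icc_succ_top (by omega)]
    · simp
    · rw [Finset.disjoint_left]
      intro s hs hs'
      have h1 := Finset.mem_Icc.1 (snd_mem_of_mem_board s hs)
      have h2 := Finset.mem_Ioc.1 (Finset.mem_product.1 hs').2
      omega

/-- The value at `x` of the factorized rook sum of the board, divided by `∏ [d_i]!`. -/
noncomputable def blockProd (t : ℕ) (h d : ℕ → ℕ) (x : ℕ) : ℤ[X] :=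
  ∏ i ∈ Finset.Icc 1 t, qBinom (x + psum h i - psum d (i - 1)) (d i)

theorem blockProd_succ (t : ℕ) (h d : ℕ → ℕ) (x : ℕ) : blockProd (t + 1) h d x =
    blockProd t h d x * qBinom (x + psum h (t + 1) - psum d t) (d (t + 1)) := by
  rw [blockProd, Finset.prod_Icc_succ_top (by omega)]; rfl

theorem rookSum_board (t : ℕ) (h d : ℕ → ℕ) (x : ℕ) :
    rookSum (psum d t) (board t h d) x =
      (∏ i ∈ Finset.Icc 1 t, qFact (d i)) * blockProd t h d x := by
  induction t with
  | zero =>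
    classical
    have h0 : NonAttacking ∅ := fun r hr => absurd hr (Finset.notMem_empty r)
    simp only [psum_zero, board_zero, rookSum, blockProd, rookPoly, inv]
    simp [Finset.filter_singleton, h0]
  | succ t ih =>
    rw [board_succ, psum_succ, rookSum_union_block snd_mem_of_mem_board, ih, blockProd_succ,
      Finset.prod_Icc_succ_top (by omega)]
    · ring
    · intro s hs
      have := Finset.mem_Icc.1 (fst_mem_of_mem_board s hs)
      rw [psum_succ, Finset.mem_Icc]; omega

/-- The part of the darga of the quotients that does not depend on `k`. -/
def dargaConst (t : ℕ) (h d : ℕ → ℕ) : ℤ :=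
  ∑ i ∈ Finset.Icc 1 t, (d i : ℤ) * ((psum h i : ℤ) - psum d i)

theorem dargaConst_succ (t : ℕ) (h d : ℕ → ℕ) : dargaConst (t + 1) h d = dargaConst t h d +
    (d (t + 1) : ℤ) * ((psum h (t + 1) : ℤ) - psum d (t + 1)) := by
  rw [dargaConst, Finset.sum_Icc_succ_top (by omega)]; rfl

theorem dargaL_eq (t : ℕ) (h d : ℕ → ℕ) {k : ℕ} (hk : k ≤ psum d t) :
    dargaL t h d k = (psum d t : ℤ) * ((psum d t - k : ℕ) : ℤ) + dargaConst t h d := by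
  have hsum : dargaConst t h d = ∑ i ∈ Finset.Icc 1 t, (psum h i : ℤ) * d i -
      ∑ i ∈ Finset.Icc 1 t, (psum d i : ℤ) * d i := by
    rw [dargaConst, ← Finset.sum_sub_distrib]
    exact Finset.sum_congr rfl fun i _ => by ring
  rw [dargaL, hsum, card_board]
  push_cast [hk]
  ring

theorem choose_two_add (n d : ℕ) :
    (n + d + 1).choose 2 + d.choose 2 = (n + 1).choose 2 + (n + d) * d := by
  induction d with
  | zero => simp
  | succ d ih =>
    have h1 := Nat.choose_succ_succ' (n + d + 1) 1
    have h2 := Nat.choose_succ_succ' d 1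
    simp only [Nat.choose_one_right, Nat.reduceAdd] at h1 h2
    rw [← add_assoc n d 1, h1, h2]
    linarith

theorem dargaN_eq (t : ℕ) (h d : ℕ → ℕ) (k : ℕ) :
    dargaN (psum d t) (board t h d) k =
      dargaL t h d k + ∑ i ∈ Finset.Icc 1 t, ((d i).choose 2 : ℤ) := by
  have key : (((psum d t + 1).choose 2 : ℕ) : ℤ) + ∑ i ∈ Finset.Icc 1 t, ((d i).choose 2 : ℤ) =
      ∑ i ∈ Finset.Icc 1 t, (psum d i : ℤ) * (d i : ℤ) := by
    induction t with
    | zero => simp [psum_zero]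
    | succ t ih =>
      rw [Finset.sum_Icc_succ_top (by omega), Finset.sum_Icc_succ_top (by omega), ← ih, psum_succ]
      have := choose_two_add (psum d t) (d (t + 1))
      zify at this
      push_cast
      linarith
  rw [dargaN, dargaL]
  linarith

/-! ### Expansion in the Gaussian basis: symmetry, then unimodality. -/

/-- The coefficients `a` in `f x = ∑ a j * qBinom (x - j + n) n`. -/
noncomputable def expansionCoeff (n : ℕ) (f : ℕ → ℤ[X]) (x : ℕ) : ℤ[X] :=
  f x - ∑ j : Fin x, expansionCoeff n f j * qBinom (x - j + n) n
termination_by x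
decreasing_by exact j.2

theorem expansionCoeff_eq (n : ℕ) (f : ℕ → ℤ[X]) (x : ℕ) : expansionCoeff n f x =
    f x - ∑ j ∈ Finset.range x, expansionCoeff n f j * qBinom (x - j + n) n := by
  rw [expansionCoeff, Finset.sum_range]

/-- The system is unitriangular: `qBinom (x + n - j) n` is `0` for `j > x` and `1` for `j = x`.
Hence the solution is unique and the factor `c` carries over without division. -/
theorem eq_mul_expansionCoeff {n : ℕ} {f b : ℕ → ℤ[X]} {c : ℤ[X]}
    (hb : ∀ x ≤ n, c * f x = ∑ j ∈ Finset.range (n + 1), b j * qBinom (x + n - j) n) {x : ℕ}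
    (hx : x ≤ n) : b x = c * expansionCoeff n f x := by
  induction x using Nat.strong_induction_on with
  | _ x ih =>
  have h1 : c * f x = ∑ j ∈ Finset.range (x + 1), b j * qBinom (x + n - j) n := by
    rw [hb x hx]
    symm
    refine Finset.sum_subset (Finset.range_mono (by omega)) fun j hj hj' => ?_
    rw [Finset.mem_range] at hj hj'
    rw [qBinom_eq_zero (by omega), mul_zero]
  rw [Finset.sum_range_succ, Nat.add_sub_cancel_left, qBinom_self, mul_one] at h1
  rw [expansionCoeff_eq, mul_sub, h1, Finset.mul_sum, eq_sub_iff_add_eq, add_comm]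
  congr 1
  refine Finset.sum_congr rfl fun j hj => ?_
  rw [Finset.mem_range] at hj
  rw [ih j hj (by omega), ← mul_assoc, show x + n - j = x - j + n by omega]

theorem expansionCoeff_mem_symmetricGroup {n : ℕ} {f : ℕ → ℤ[X]} {e : ℤ}
    (hf : ∀ x : ℕ, f x ∈ symmetricGroup (n * x + e)) (x : ℕ) :
    expansionCoeff n f x ∈ symmetricGroup (n * x + e) := by
  induction x using Nat.strong_induction_on with
  | _ x ih =>
  rw [expansionCoeff_eq]
  refine sub_mem (hf x) (sum_mem fun j hj => ?_)
  rw [Finset.mem_range] at hj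
  have := mul_mem_symmetricGroup (ih j hj) (unimodalCone_le _ (qBinom_mem_unimodalCone (x - j + n) n))
  convert this using 2
  push_cast [hj.le]
  ring

theorem blockProd_mem_unimodalCone {t : ℕ} {h d : ℕ → ℕ} (hd : ∀ i, 1 ≤ i → i ≤ t → 0 < d i)
    (x : ℕ) : blockProd t h d x ∈ unimodalCone (psum d t * x + dargaConst t h d) := by
  have hsum : (psum d t * x + dargaConst t h d : ℤ) =
      ∑ i ∈ Finset.Icc 1 t, (d i : ℤ) * (x + psum h i - psum d i) := by
    rw [dargaConst, psum]
    push_cast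
    rw [Finset.sum_mul, ← Finset.sum_add_distrib]
    exact Finset.sum_congr rfl fun i _ => by ring
  rw [hsum]
  refine prod_mem_unimodalCone _ _ _ fun i hi => ?_
  rw [Finset.mem_Icc] at hi
  obtain ⟨i, rfl⟩ := Nat.exists_eq_add_of_le' hi.1
  rw [Nat.add_sub_cancel, psum_succ d]
  have hdi := hd (i + 1) (by omega) hi.2
  rcases lt_or_ge (x + psum h (i + 1)) (psum d i) with h' | h'
  · rw [qBinom_eq_zero (by omega)]; exact zero_mem _
  · convert qBinom_mem_unimodalCone (x + psum h (i + 1) - psum d i) (d (i + 1)) using 2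
    push_cast [h']
    ring

/-- Multiplying by one more Gaussian binomial coefficient preserves nonnegativity and unimodality
of the expansion coefficients. -/
theorem exists_expansion_mul_qBinom {n d H : ℕ} {e : ℤ} {f b : ℕ → ℤ[X]}
    (hf : ∀ x, f x = ∑ j ∈ Finset.range (n + 1), b j * qBinom (x + n - j) n)
    (hb : ∀ j : ℕ, b j ∈ unimodalCone (n * j + e))
    (hlow : ∀ j, b j ≠ 0 → n ≤ H + j) (hup : ∀ j ≤ n, b j ≠ 0 → H + j ≤ 2 * n + d) :
    ∃ b' : ℕ → ℤ[X],
      (∀ x, f x * qBinom (x + H - n) d =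
        ∑ l ∈ Finset.range (n + d + 1), b' l * qBinom (x + (n + d) - l) (n + d)) ∧
      (∀ l : ℕ, b' l ∈ unimodalCone (((n + d : ℕ) : ℤ) * l + (e + d * (H - (n + d : ℕ))))) ∧
      ∀ l, b' l ≠ 0 → n + d ≤ H + l ∧ l + H ≤ n + d + n := by
  -- Nanjundiah's identity is applied with `a = H + j - n` and `b = n + d - a`; `hlow` and `hup` say
  -- that both are nonnegative whenever `b j ≠ 0`.
  set w : ℕ → ℕ × ℕ → ℤ[X] := fun j p => b j * (X ^ (p.2 * (H + j - n - p.1)) *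
    qBinom (H + j - n) p.1 * qBinom (n + d - (H + j - n)) p.2) with hw
  have hw0 : ∀ j ≤ n, ∀ p : ℕ × ℕ, w j p ≠ 0 → n ≤ H + j ∧ H + j ≤ 2 * n + d ∧
      p.1 ≤ H + j - n ∧ p.2 ≤ n + d - (H + j - n) := by
    intro j hj p h
    simp only [hw, mul_ne_zero_iff] at h
    refine ⟨hlow j h.1, hup j hj h.1, ?_, ?_⟩
    · by_contra! hlt; exact h.2.1.2 (qBinom_eq_zero hlt)
    · by_contra! hlt; exact h.2.2 (qBinom_eq_zero hlt)
  refine ⟨fun l => ∑ j ∈ Finset.range (n + 1), ∑ p ∈ Finset.HasAntidiagonal.antidiagonal d,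
    if j + p.2 = l then w j p else 0, fun x => ?_, fun l => ?_, fun l hl => ?_⟩
  · simp only [Finset.sum_mul]
    rw [Finset.sum_comm, hf, Finset.sum_mul]
    refine Finset.sum_congr rfl fun j hj => ?_
    rw [Finset.mem_range] at hj
    rw [Finset.sum_comm]
    have hterm : ∀ p ∈ Finset.HasAntidiagonal.antidiagonal d,
        ∑ l ∈ Finset.range (n + d + 1), (if j + p.2 = l then w j p else 0) *
          qBinom (x + (n + d) - l) (n + d) = w j p * qBinom (x + (n + d) - (j + p.2)) (n + d) := by
      intro p hp
      have hp : p.1 + p.2 = d := by simpa using hp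
      simp only [ite_mul, zero_mul, Finset.sum_ite_eq, Finset.mem_range]
      rw [if_pos (by omega)]
    rw [Finset.sum_congr rfl hterm]
    rcases eq_or_ne (b j) 0 with h0 | h0
    · simp [hw, h0]
    rcases lt_or_ge x j with hxj | hxj
    -- For `x < j` both sides vanish, so `x = j + u` may be assumed.
    · rw [qBinom_eq_zero (show x + n - j < n by omega), mul_zero, zero_mul]
      refine (Finset.sum_eq_zero fun p _ => ?_).symm
      rw [qBinom_eq_zero (by omega), mul_zero]
    · obtain ⟨u, rfl⟩ := Nat.exists_eq_add_of_le hxj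
      have h1 := hlow j h0
      have h2 := hup j (by omega) h0
      rw [show j + u + n - j = n + u by omega, show j + u + H - n = H + j - n + u by omega,
        mul_assoc, qBinom_mul_qBinom_eq_sum (b := n + d - (H + j - n)) (by omega), Finset.mul_sum]
      refine Finset.sum_congr rfl fun p hp => ?_
      have hp : p.1 + p.2 = d := by simpa using hp
      rw [show j + u + (n + d) - (j + p.2) = p.1 + (n + u) by omega, hw]
      ring
  · refine sum_mem fun j hj => sum_mem fun p hp => ?_
    have hp : p.1 + p.2 = d := by simpa using hp
    rw [Finset.mem_range] at hj
    split_ifs with hl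
    swap
    · exact zero_mem _
    rcases eq_or_ne (w j p) 0 with h0 | h0
    · rw [h0]; exact zero_mem _
    obtain ⟨h1, h2, h3, h4⟩ := hw0 j (by omega) p h0
    have hm := mul_mem_unimodalCone (hb j) (mul_mem_unimodalCone (mul_mem_unimodalCone
      (X_pow_mem_unimodalCone (p.2 * (H + j - n - p.1))) (qBinom_mem_unimodalCone (H + j - n) p.1))
      (qBinom_mem_unimodalCone (n + d - (H + j - n)) p.2))
    convert hm using 2
    obtain ⟨a, ha⟩ := Nat.exists_eq_add_of_le h1
    rw [show H + j - n = a by omega] at h3 h4 ⊢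
    have haH : (H : ℤ) = n + a - j := by omega
    have had : a ≤ n + d := by omega
    push_cast [h3, had]
    rw [haH, ← hp, ← hl]
    push_cast
    ring
  · obtain ⟨j, hj, hj'⟩ := Finset.exists_ne_zero_of_sum_ne_zero hl
    obtain ⟨p, hp, hp'⟩ := Finset.exists_ne_zero_of_sum_ne_zero hj'
    have hp : p.1 + p.2 = d := by simpa using hp
    rw [Finset.mem_range] at hj
    obtain ⟨hl, hw'⟩ := ite_ne_right_iff.1 hp'
    have := hw0 j (by omega) p hw'
    omega

/-- The bounds on the support of `b` are part of the induction: the lower one gives the first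
inequality needed for the next block, and the upper one, with `h_{s+1} ≤ d_s + d_{s+1}`, gives the
second. Under condition 2 the second follows from `j ≤ D_s` alone. -/
theorem exists_expansion_blockProd {t : ℕ} {h d : ℕ → ℕ} (hd0 : d 0 = 0)
    (hyp : (∀ i, 1 ≤ i → i ≤ t → h i ≤ d (i - 1) + d i) ∨
      (∀ i, 1 ≤ i → i ≤ t → psum h i ≤ psum d i)) {s : ℕ} (hs : s ≤ t) :
    ∃ b : ℕ → ℤ[X],
      (∀ x, blockProd s h d x =
        ∑ j ∈ Finset.range (psum d s + 1), b j * qBinom (x + psum d s - j) (psum d s)) ∧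
      (∀ j : ℕ, b j ∈ unimodalCone (psum d s * j + dargaConst s h d)) ∧
      ∀ j, b j ≠ 0 → psum d s ≤ psum h s + j ∧ j + psum h s ≤ psum d s + psum d (s - 1) := by
  induction s with
  | zero =>
    refine ⟨fun j => if j = 0 then 1 else 0, fun x => ?_, fun j => ?_, fun j hj => ?_⟩
    · simp [psum_zero, blockProd]
    · simp only [psum_zero, dargaConst]
      split_ifs
      · simpa using one_mem_unimodalCone
      · exact zero_mem _
    · obtain ⟨rfl, -⟩ := ite_ne_right_iff.1 hj
      simp [psum_zero]
  | succ s ih =>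
    obtain ⟨b, hb1, hb2, hb3⟩ := ih (by omega)
    obtain ⟨b', h1, h2, h3⟩ := exists_expansion_mul_qBinom (d := d (s + 1)) (H := psum h (s + 1))
      hb1 hb2 (fun j hj => by have := hb3 j hj; rw [psum_succ]; omega) (fun j hj hj' => by
        have := hb3 j hj'
        rcases hyp with hyp | hyp
        · have h1 := hyp (s + 1) (by omega) hs
          have h2 : psum d s = psum d (s - 1) + d s := by
            cases s with
            | zero => simp [psum_zero, hd0]
            | succ s => exact psum_succ d s
          rw [Nat.add_sub_cancel] at h1
          rw [psum_succ]
          omega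
        · have h1 := hyp (s + 1) (by omega) hs
          rw [psum_succ d] at h1
          omega)
    refine ⟨b', fun x => ?_, fun l => ?_, fun l hl => ?_⟩
    · rw [blockProd_succ, h1, psum_succ d]
    · rw [dargaConst_succ, psum_succ d]; exact h2 l
    · rw [Nat.add_sub_cancel, psum_succ d]; exact h3 l hl

/-- The index is reversed, `j = n - k`, to make the system triangular from `x = 0` upwards. -/
theorem hitPoly_board_eq (t : ℕ) (h d : ℕ → ℕ) {k : ℕ} (hk : k ≤ psum d t) :
    hitPoly (psum d t) (board t h d) k = (∏ i ∈ Finset.Icc 1 t, qFact (d i)) *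
      expansionCoeff (psum d t) (blockProd t h d) (psum d t - k) := by
  rw [← eq_mul_expansionCoeff (b := fun j => hitPoly (psum d t) (board t h d) (psum d t - j))
    (fun x _ => ?_) (Nat.sub_le _ _), Nat.sub_sub_self hk]
  rw [← rookSum_board, ← sum_hitPoly_mul_qBinom, ← Finset.sum_range_reflect]
  refine Finset.sum_congr rfl fun j hj => ?_
  rw [Finset.mem_range] at hj
  rw [Nat.add_sub_cancel, show x + (psum d t - j) = x + psum d t - j by omega]

end QRook

theorem theorem7 (t : ℕ) (h d : ℕ → ℕ) (hd0 : d 0 = 0)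
    (hd : ∀ i, 1 ≤ i → i ≤ t → 0 < d i) (k : ℕ) (hk : k ≤ QRook.psum d t) :
    (QRook.hitPoly (QRook.psum d t) (QRook.board t h d) k = 0 ∨
      (QRook.IsSymmetric (QRook.hitPoly (QRook.psum d t) (QRook.board t h d) k) ∧
        (QRook.darga (QRook.hitPoly (QRook.psum d t) (QRook.board t h d) k) : ℤ) =
          QRook.dargaN (QRook.psum d t) (QRook.board t h d) k)) ∧
    ∃ f : Polynomial ℤ,
      QRook.hitPoly (QRook.psum d t) (QRook.board t h d) k =
        f * ∏ i ∈ Finset.Icc 1 t, QRook.qFact (d i) ∧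
      (f = 0 ∨ (QRook.IsSymmetric f ∧ (QRook.darga f : ℤ) = QRook.dargaL t h d k)) ∧
      (((∀ i, 1 ≤ i → i ≤ t → h i ≤ d (i - 1) + d i) ∨
        (∀ i, 1 ≤ i → i ≤ t → QRook.psum h i ≤ QRook.psum d i)) →
        QRook.Zsu f (QRook.dargaL t h d k)) := by
  set f := QRook.expansionCoeff (QRook.psum d t) (QRook.blockProd t h d) (QRook.psum d t - k)
    with hf
  have hT : QRook.hitPoly (QRook.psum d t) (QRook.board t h d) k =
      f * ∏ i ∈ Finset.Icc 1 t, QRook.qFact (d i) := by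
    rw [QRook.hitPoly_board_eq t h d hk, mul_comm]
  have hfs : f ∈ QRook.symmetricGroup (QRook.dargaL t h d k) := by
    rw [QRook.dargaL_eq t h d hk]
    exact QRook.expansionCoeff_mem_symmetricGroup (fun x =>
      QRook.unimodalCone_le _ (QRook.blockProd_mem_unimodalCone hd x)) _
  have hTs : QRook.hitPoly (QRook.psum d t) (QRook.board t h d) k ∈
      QRook.symmetricGroup (QRook.dargaN (QRook.psum d t) (QRook.board t h d) k) := by
    rw [hT, QRook.dargaN_eq]
    exact QRook.mul_mem_symmetricGroup hfs (QRook.unimodalCone_le _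
      (QRook.prod_mem_unimodalCone _ _ _ fun i _ => QRook.qFact_mem_unimodalCone (d i)))
  have hsymm : ∀ {g : Polynomial ℤ} {e : ℤ}, g ∈ QRook.symmetricGroup e →
      g = 0 ∨ (QRook.IsSymmetric g ∧ (QRook.darga g : ℤ) = e) := fun {g e} hg => by
    rcases eq_or_ne g 0 with h0 | h0
    · exact Or.inl h0
    · exact Or.inr ⟨QRook.isSymmetric_of_mem hg, QRook.darga_eq_of_mem hg h0⟩
  refine ⟨hsymm hTs, f, hT, hsymm hfs, fun hyp => QRook.zsu_of_mem ?_⟩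
  obtain ⟨b, hb1, hb2, -⟩ := QRook.exists_expansion_blockProd hd0 hyp le_rfl
  -- By uniqueness, the nonnegative expansion has the same coefficients as the one from back
  -- substitution.
  have hfb : b (QRook.psum d t - k) = 1 * f :=
    QRook.eq_mul_expansionCoeff (fun x _ => by rw [one_mul, hb1]) (Nat.sub_le _ _)
  rw [QRook.dargaL_eq t h d hk, ← one_mul f, ← hfb]
  exact hb2 _
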